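/- Let $M$ be a connected smooth riemannian surface without boundary, and let $p_M:\widetilde M\to M$ be its universal cover with the induced riemannian metric. A *tame conformally euclidean structure* on $M$ is a conformal embedding $\widetilde M\subset\mathbb E^2$ (preserving non-oriented angles) into the euclidean plane such that (i) any two points of $\widetilde M$ are joined by a unique shortest geodesic of $\widetilde M$, and (ii) for every compact $K\subset\widetilde M$ there is a regular map $f:\mathbb E^2\to\widetilde M$ (a $C^1$ map whose derivative is injective at every point) with $f|_K=\mathrm{id}_K$. A *regular closed curve* on $M$ is a $C^1$ curve $\gamma:[a,b]\to M$ $(a<b)$ whose velocity $v_\gamma$ vanishes nowhere, with $\gamma(a)=\gamma(b)$ (the *base point*) and $e_\gamma(a)=e_\gamma(b)$ (the *base direction*), where $e_\gamma=v_\gamma/|v_\gamma|$. A *regular homotopy* between two regular closed curves on $[a,b]$ is a family $\{\sigma_t\}_{0\le t\le1}$ of regular closed curves $\sigma_t:[a,b]\to M$ joining them such that $\sigma_t(u)$ and the velocity $v_{\sigma_t}(u)$ are continuous in $(t,u)$; it fixes the base point and the base direction if these are the same for all $\sigma_t$. For a regular $C^1$ curve $c:[a,b]\to\mathbb E^2$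 let $\theta:[a,b]\to\mathbb R$ be a continuous function with $c'(u)/|c'(u)|=(\cos\theta(u),\sin\theta(u))$ for all $u$; the *$i$-index* of $c$ is $i_c=\dfrac{\theta(b)-\theta(a)}{2\pi}\in\mathbb R$, which does not depend on the choice of $\theta$. **Theorem.** Let $\gamma_1,\gamma_2:[a,b]\to M$ be regular closed curves on a surface $M$ with a tame conformally euclidean structure $\widetilde M\subset\mathbb E^2$. Suppose that they have the same base point $p$ and the same base direction. Let $\widetilde p\in\widetilde M$ be a point over $p$, and let $\widetilde\gamma_1,\widetilde\gamma_2$ be the lifts of $\gamma_1,\gamma_2$ to $\widetilde M\subset\mathbb E^2$ with initial point $\widetilde p$. Then the following are equivalent. 1. $\gamma_1$ and $\gamma_2$ are regularly homotopic fixing the base point and the base direction. 2. $[\gamma_1]=[\gamma_2]\in\pi_1(M,p)$ and $i_{\widetilde\gamma_1}=i_{\widetilde\gamma_2}$. -/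

import Mathlib

open Set Bundle Manifold
open scoped Manifold ContDiff Bundle

/- Switched off so that the plane always carries its standard charted space structure
`chartedSpaceSelf`, and not a definitionally equal wrapper of it. -/
attribute [-instance] TopCat.of.chartedSpace

noncomputable section

/-- The euclidean plane. -/
abbrev Plane : Type := EuclideanSpace ℝ (Fin 2)

/-! ### Curves on the plane -/

/-- The velocity of a plane curve `c : [a, b] → Plane`
(one-sided at the end points; values of `c` outside `[a, b]` play no role). -/
def planeVelocity (a b : ℝ) (c : ℝ → Plane) (u : ℝ) : Plane :=
  derivWithin c (Icc a b) u

/-- The direction of a plane curve: its velocity divided by the length of the velocity. -/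
def planeDirection (a b : ℝ) (c : ℝ → Plane) (u : ℝ) : Plane :=
  ‖planeVelocity a b c u‖⁻¹ • planeVelocity a b c u

/-- `θ : [a, b] → ℝ` is an angle function for the plane curve `c`: it is continuous, and the
direction of `c` at `u` is `(cos (θ u), sin (θ u))`. -/
structure IsAngleFunction (a b : ℝ) (c : ℝ → Plane) (θ : ℝ → ℝ) : Prop where
  continuousOn : ContinuousOn θ (Icc a b)
  direction_eq : ∀ u ∈ Icc a b, planeDirection a b c u = !₂[Real.cos (θ u), Real.sin (θ u)]

open Classical in
/-- The `i`-index of a plane curve on `[a, b]`: the total change of an angle function, divided by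
`2π`. A regular curve has an angle function, and the value does not depend on its choice.
(For a curve without angle function, in particular one that is not regular, the value is `0`.) -/
def iIndex (a b : ℝ) (c : ℝ → Plane) : ℝ :=
  if h : ∃ θ : ℝ → ℝ, IsAngleFunction a b c θ then
    (h.choose b - h.choose a) / (2 * Real.pi)
  else 0

/-! ### Curves on a surface -/

section Surface

variable {M : Type*} [TopologicalSpace M] [ChartedSpace Plane M]

/-- The velocity at time `u` of a curve `γ : [a, b] → M` (one-sided at the end points),
as a point of the tangent bundle, that is, together with its foot point `γ u`. -/
def velocity (a b : ℝ) (γ : ℝ → M) (u : ℝ) : TangentBundle (𝓡 2) M :=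
  ⟨γ u, mfderivWithin 𝓘(ℝ, ℝ) (𝓡 2) γ (Icc a b) u (1 : ℝ)⟩

variable [IsManifold (𝓡 2) ∞ M] [RiemannianBundle (fun x : M ↦ TangentSpace (𝓡 2) x)]

/-- The direction of a curve `γ : [a, b] → M` on a riemannian surface: its velocity divided by the
length of the velocity, as a point of the tangent bundle. Two directions are equal
if and only if their foot points and the unit vectors there agree. -/
def direction (a b : ℝ) (γ : ℝ → M) (u : ℝ) : TangentBundle (𝓡 2) M :=
  ⟨γ u, ‖(velocity a b γ u).2‖⁻¹ • (velocity a b γ u).2⟩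

/-- A regular closed curve `γ : [a, b] → M`: it is of class `C¹`, its velocity vanishes nowhere, its
end points coincide, and so do its directions there. -/
structure IsRegularClosedCurve (a b : ℝ) (γ : ℝ → M) : Prop where
  contMDiffOn : ContMDiffOn 𝓘(ℝ, ℝ) (𝓡 2) 1 γ (Icc a b)
  velocity_ne_zero : ∀ u ∈ Icc a b, (velocity a b γ u).2 ≠ 0
  closed : γ a = γ b
  direction_eq : direction a b γ a = direction a b γ b

/-- `σ` is a regular homotopy between the regular closed curves `γ₁` and `γ₂`: every stage is a
regular closed curve, and the velocity (with its foot point) is continuous in both variables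
jointly, i.e. `σ t` varies continuously in the `C¹` sense. -/
structure IsRegularHomotopy (a b : ℝ) (γ₁ γ₂ : ℝ → M) (σ : ℝ → ℝ → M) : Prop where
  regular : ∀ t ∈ Icc (0 : ℝ) 1, IsRegularClosedCurve a b (σ t)
  continuousOn : ContinuousOn (fun q : ℝ × ℝ ↦ velocity a b (σ q.1) q.2)
    (Icc (0 : ℝ) 1 ×ˢ Icc a b)
  start : EqOn (σ 0) γ₁ (Icc a b)
  finish : EqOn (σ 1) γ₂ (Icc a b)

/-- `γ₁` and `γ₂` are regularly homotopic fixing the base point and the base direction. -/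
def RegularlyHomotopicFixingBase (a b : ℝ) (γ₁ γ₂ : ℝ → M) : Prop :=
  ∃ σ : ℝ → ℝ → M, IsRegularHomotopy a b γ₁ γ₂ σ ∧
    ∀ t ∈ Icc (0 : ℝ) 1, σ t a = γ₁ a ∧ direction a b (σ t) a = direction a b γ₁ a

/-- The loop `[0, 1] → M` obtained from a continuous closed curve `γ : [a, b] → M` based at `p` by
the affine change of parameter. -/
def loopOfCurve {a b : ℝ} (hab : a < b) {p : M} {γ : ℝ → M}
    (hγ : ContinuousOn γ (Icc a b)) (ha : γ a = p) (hb : γ b = p) : Path p p where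
  toFun s := γ (a + (s : ℝ) * (b - a))
  continuous_toFun := by
    refine hγ.comp_continuous (by fun_prop) fun s ↦ ⟨?_, ?_⟩
    · nlinarith [s.2.1]
    · nlinarith [s.2.2]
  source' := by simpa using ha
  target' := by simpa using hb

/-- The class in `π₁(M, p)` of a regular closed curve with base point `p`. -/
def IsRegularClosedCurve.homotopyClass {a b : ℝ} (hab : a < b) {p : M} {γ : ℝ → M}
    (h : IsRegularClosedCurve a b γ) (ha : γ a = p) : FundamentalGroup M p :=
  FundamentalGroup.fromPath (Path.Homotopic.Quotient.mk
    (loopOfCurve hab h.contMDiffOn.continuousOn ha (h.closed ▸ ha)))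

/-- `c : [0, 1] → M` is a geodesic from `x` to `y`: a `C¹` curve of constant speed which locally
minimizes length among the curves of the surface. -/
structure IsGeodesicFromTo (c : ℝ → M) (x y : M) : Prop where
  contMDiffOn : ContMDiffOn 𝓘(ℝ, ℝ) (𝓡 2) 1 c (Icc 0 1)
  source : c 0 = x
  target : c 1 = y
  constant_speed : ∃ r : ℝ, ∀ u ∈ Icc (0 : ℝ) 1, ‖(velocity 0 1 c u).2‖ = r
  locally_minimizing : ∀ u ∈ Icc (0 : ℝ) 1, ∃ δ > 0,
    ∀ s ∈ Icc (0 : ℝ) 1, ∀ t ∈ Icc (0 : ℝ) 1, s ≤ t → |s - u| < δ → |t - u| < δ →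
      pathELength (𝓡 2) c s t = riemannianEDist (𝓡 2) (c s) (c t)

/-- A geodesic from `x` to `y` whose length is minimal among the geodesics from `x` to `y`. -/
def IsShortestGeodesicFromTo (c : ℝ → M) (x y : M) : Prop :=
  IsGeodesicFromTo c x y ∧
    ∀ c' : ℝ → M, IsGeodesicFromTo c' x y → pathELength (𝓡 2) c 0 1 ≤ pathELength (𝓡 2) c' 0 1

end Surface

/-! ### Universal covers and tame conformally euclidean structures -/

section Cover

variable {M : Type*} [TopologicalSpace M] [ChartedSpace Plane M] [IsManifold (𝓡 2) ∞ M]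
  [RiemannianBundle (fun x : M ↦ TangentSpace (𝓡 2) x)]
  {Mt : Type*} [TopologicalSpace Mt] [ChartedSpace Plane Mt] [IsManifold (𝓡 2) ∞ Mt]
  [RiemannianBundle (fun x : Mt ↦ TangentSpace (𝓡 2) x)]

/-- `pr : Mt → M` is the universal cover of the riemannian surface `M`, with the smooth
structure and the riemannian metric induced from `M`. -/
structure IsRiemannianUniversalCover (pr : Mt → M) : Prop where
  simplyConnected : SimplyConnectedSpace Mt
  isCoveringMap : IsCoveringMap pr
  surjective : Function.Surjective pr
  isLocalDiffeomorph : IsLocalDiffeomorph (𝓡 2) (𝓡 2) ∞ pr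
  inner_eq : ∀ (x : Mt) (v w : TangentSpace (𝓡 2) x),
    inner ℝ (mfderiv (𝓡 2) (𝓡 2) pr x v) (mfderiv (𝓡 2) (𝓡 2) pr x w) = inner ℝ v w

/-- `φ` is a conformal embedding of the surface `Mt` (without boundary) into the plane. As the
dimensions agree, an embedding is an injective local diffeomorphism; it is conformal if its
derivative at each point multiplies the inner product by a positive factor, that is,
preserves the non-oriented angles. -/
structure IsConformalEmbedding (φ : Mt → Plane) : Prop where
  injective : Function.Injective φ
  isLocalDiffeomorph : IsLocalDiffeomorph (𝓡 2) (𝓡 2) ∞ φ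
  conformal : ∀ x : Mt, ∃ k : ℝ, 0 < k ∧ ∀ v w : TangentSpace (𝓡 2) x,
    inner ℝ (mfderiv (𝓡 2) (𝓡 2) φ x v) (mfderiv (𝓡 2) (𝓡 2) φ x w) = k * inner ℝ v w

/-- A tame conformally euclidean structure, given by the embedding `φ` of the universal cover `Mt`:
`φ` is a conformal embedding, any two points of `Mt` are joined by a unique shortest geodesic, and
for every compact subset `K` of `φ(Mt)` (an open subset of the plane) there is a
regular map `f` from the plane to `φ(Mt)`, i.e. a `C¹` map with injective derivatives, which is the
identity on `K`. -/
structure IsTameConformallyEuclidean (φ : Mt → Plane) : Prop where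
  isConformalEmbedding : IsConformalEmbedding φ
  exists_shortest : ∀ x y : Mt, ∃ c : ℝ → Mt, IsShortestGeodesicFromTo c x y
  unique_shortest : ∀ (x y : Mt) (c c' : ℝ → Mt), IsShortestGeodesicFromTo c x y →
    IsShortestGeodesicFromTo c' x y → EqOn c c' (Icc 0 1)
  exists_retraction : ∀ K : Set Plane, IsCompact K → K ⊆ range φ →
    ∃ f : Plane → Plane, ContDiff ℝ 1 f ∧ (∀ x, Function.Injective (fderiv ℝ f x)) ∧
      (∀ x, f x ∈ range φ) ∧ EqOn f id K

end Cover

/-- `γt : [a, b] → Mt` is the lift of `γ : [a, b] → M` with initial point `pt`. -/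
structure IsLiftFrom {M Mt : Type*} [TopologicalSpace Mt] (pr : Mt → M) (a b : ℝ) (γ : ℝ → M) (pt : Mt) (γt : ℝ → Mt) : Prop where
  continuousOn : ContinuousOn γt (Icc a b)
  initial : γt a = pt
  proj_eq : ∀ u ∈ Icc a b, pr (γt u) = γ u


end

/-!
The theorem is reduced to a relative Whitney–Graustein theorem in the plane.

A regular curve in the plane is determined by its initial point and by a continuous logarithm `L` of
its velocity, whose imaginary part is an angle function. Curves with given end points and end
directions and given index correspond to the logarithms with `∫ exp L = D` and with given imaginary
parts at the end points (`logVelocitySpace`), and it has to be shown that this space is path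
connected (`joinedIn_logVelocitySpace`). A linear homotopy of `L` changes the displacement `∫ exp L`
only a little if it is supported in a small interval, and then a small multiple of a fixed bump
elsewhere corrects it; in this way every `L` is deformed so that the direction makes two full turns
with constant angular velocity in a short interval (`exists_joinedIn_eq_ramp`). Between two such
logarithms the linear homotopy keeps these two turns, on which any error in the displacement
can be compensated by an increase of the speed (`integral_speed_mul_exp_ramp`,
`joinedIn_of_eq_ramp`).

If two curves on `M` have the same class in `π₁` then their lifts have the same end points, and the
plane theorem gives a regular homotopy of the lifts in the plane. It may leave the image of the
cover, but the regular map `f` of the tame structure, applied with `K` the union of the two lifts,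
pushes it back into the image. It keeps the two lifts, and therefore also their end points and
the velocities there, and the covering map carries the result to `M`
(`regularlyHomotopicFixingBase_of_planar`).

Conversely a regular homotopy on `M` lifts to the cover, and its velocities in the plane are
continuous in both variables and nowhere zero. So they have a continuous logarithm on the rectangle,
whose imaginary part is constant along the two sides on which the end directions are fixed
(`RegularlyHomotopicFixingBase.iIndex_eq`).
-/

/-! ### Logarithms of velocities -/

/-- The space of logarithms of velocities of regular curves `c` on `[a, b]` in the complex plane
with `c b - c a = D`, and with prescribed angles `α` and `β` of the velocities at the end points.
The real part of a logarithm is the logarithm of the speed, the imaginary part is an angle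
function. -/
def logVelocitySpace (a b : ℝ) (D : ℂ) (α β : ℝ) : Set C(ℝ, ℂ) :=
  {L | ∫ u in a..b, Complex.exp (L u) = D ∧ (L a).im = α ∧ (L b).im = β}

theorem joinedIn_logVelocitySpace_of_homotopy {a b : ℝ} {D : ℂ} {α β : ℝ} {L₁ L₂ : C(ℝ, ℂ)}
    {H : unitInterval × ℝ → ℂ} (hH : Continuous H) (h₀ : ∀ u, H (0, u) = L₁ u)
    (h₁ : ∀ u, H (1, u) = L₂ u)
    (hint : ∀ t, ∫ u in a..b, Complex.exp (H (t, u)) = D)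
    (ha : ∀ t, (H (t, a)).im = α) (hb : ∀ t, (H (t, b)).im = β) :
    JoinedIn (logVelocitySpace a b D α β) L₁ L₂ :=
  ⟨{ toContinuousMap := ContinuousMap.curry ⟨H, hH⟩
     source' := by ext u; simpa using h₀ u
     target' := by ext u; simpa using h₁ u }, fun t ↦ ⟨hint t, ha t, hb t⟩⟩

/-- The linear function that runs from `-2π` to `2π` on the interval of radius `δ` around `c`. -/
noncomputable def ramp (c δ u : ℝ) : ℝ := 2 * Real.pi * ((u - c) / δ)

@[fun_prop]
theorem continuous_ramp (c δ : ℝ) : Continuous (ramp c δ) := by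
  unfold ramp; fun_prop

theorem integral_exp_int_mul_pi {m : ℤ} (hm : m ≠ 0) :
    ∫ x in (-1 : ℝ)..1, Complex.exp (m * Real.pi * Complex.I * x) = 0 := by
  have hc : (m * Real.pi * Complex.I : ℂ) ≠ 0 := by
    simp [hm, Real.pi_ne_zero]
  rw [integral_exp_mul_complex hc, div_eq_zero_iff]
  left
  rw [sub_eq_zero, Complex.exp_eq_exp_iff_exists_int]
  exact ⟨m, by push_cast; ring⟩

/-- A curve whose direction turns with constant angular velocity through two full circles can be
given any displacement `E` by a choice of its speed. The weight `1 + cos (π x)` vanishes at the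
end points, and is orthogonal to the frequencies `1` and `2` that occur in the integral. -/
theorem integral_speed_mul_exp_ramp {c δ : ℝ} (hδ : 0 < δ) (E : ℂ) :
    ∫ u in (c - δ)..(c + δ),
      ((((1 + Real.cos (Real.pi * ((u - c) / δ))) *
        (‖E‖ + (E * Complex.exp (-(ramp c δ u * Complex.I))).re) / δ : ℝ) : ℂ) *
        Complex.exp (ramp c δ u * Complex.I)) = E := by
  set e : ℤ → ℝ → ℂ := fun m x ↦ Complex.exp (m * Real.pi * Complex.I * x) with he
  have hcont : ∀ m, Continuous (e m) := fun m ↦ by simp only [he]; fun_prop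
  have hint : ∀ m, m ≠ 0 → ∫ x in (-1 : ℝ)..1, e m x = 0 := fun m hm ↦ integral_exp_int_mul_pi hm
  set f : ℝ → ℂ := fun x ↦ (1 / δ : ℂ) * (E / 2 + E / 4 * e 1 x + E / 4 * e (-1) x
    + ‖E‖ * e 2 x + ‖E‖ / 2 * e 3 x + ‖E‖ / 2 * e 1 x
    + starRingEnd ℂ E / 2 * e 4 x + starRingEnd ℂ E / 4 * e 5 x
    + starRingEnd ℂ E / 4 * e 3 x) with hf
  have hδ' : (δ : ℂ) ≠ 0 := by exact_mod_cast hδ.ne'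
  have key : ∀ u : ℝ, ((((1 + Real.cos (Real.pi * ((u - c) / δ))) *
        (‖E‖ + (E * Complex.exp (-(ramp c δ u * Complex.I))).re) / δ : ℝ) : ℂ) *
        Complex.exp (ramp c δ u * Complex.I)) = f (u / δ - c / δ) := by
    intro u
    set x : ℝ := (u - c) / δ with hx
    have hx' : u / δ - c / δ = x := by rw [hx]; ring
    rw [hx']
    set w := Complex.exp (Real.pi * Complex.I * x) with hw
    have hw0 : w ≠ 0 := Complex.exp_ne_zero _
    have hen : ∀ n : ℕ, e n x = w ^ n := by
      intro n
      simp only [he, hw, ← Complex.exp_nat_mul]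
      congr 1; push_cast; ring
    have hem : e (-1) x = w⁻¹ := by
      simp only [he, hw, ← Complex.exp_neg]
      congr 1; push_cast; ring
    have hr : Complex.exp (ramp c δ u * Complex.I) = w ^ 2 := by
      rw [hw, ← Complex.exp_nat_mul]
      congr 1; simp only [ramp, ← hx]; push_cast; ring
    have hr' : Complex.exp (-(ramp c δ u * Complex.I)) = (w ^ 2)⁻¹ := by
      rw [Complex.exp_neg, hr]
    have hcos : ((Real.cos (Real.pi * x) : ℝ) : ℂ) = (w + w⁻¹) / 2 := by
      rw [hw, ← Complex.exp_neg, Complex.ofReal_cos, Complex.cos]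
      congr 3 <;> push_cast <;> ring
    have hconj : starRingEnd ℂ (w ^ 2)⁻¹ = w ^ 2 := by
      rw [← hr', ← hr, ← Complex.exp_conj]
      congr 1; simp
    have hre : (((E * (w ^ 2)⁻¹).re : ℝ) : ℂ) = (E * (w ^ 2)⁻¹ + starRingEnd ℂ E * w ^ 2) / 2 := by
      rw [Complex.re_eq_add_conj, map_mul, hconj]
    have h1 := hen 1; have h2 := hen 2; have h3 := hen 3; have h4 := hen 4; have h5 := hen 5
    norm_cast at h1 h2 h3 h4 h5
    simp only [hf, h1, h2, h3, h4, h5, hem]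
    rw [hr, hr']
    push_cast [hre, hcos]
    field_simp
    ring
  simp_rw [key]
  rw [intervalIntegral.integral_comp_div_sub f hδ.ne']
  have e1 : (c + δ) / δ - c / δ = 1 := by field_simp; ring
  have e2 : (c - δ) / δ - c / δ = -1 := by field_simp; ring
  rw [e1, e2]
  have hi : ∀ (k : ℂ) m, IntervalIntegrable (fun x ↦ k * e m x) MeasureTheory.volume (-1) 1 :=
    fun k m ↦ ((hcont m).const_mul k |>.intervalIntegrable _ _)
  have hic : IntervalIntegrable (fun _ : ℝ ↦ E / 2) MeasureTheory.volume (-1) 1 := by simp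
  simp only [hf]
  rw [intervalIntegral.integral_const_mul]
  rw [intervalIntegral.integral_add, intervalIntegral.integral_add, intervalIntegral.integral_add,
    intervalIntegral.integral_add, intervalIntegral.integral_add, intervalIntegral.integral_add,
    intervalIntegral.integral_add, intervalIntegral.integral_add]
  · simp only [intervalIntegral.integral_const_mul]
    rw [hint 1 (by norm_num), hint (-1) (by norm_num), hint 2 (by norm_num), hint 3 (by norm_num),
      hint 4 (by norm_num), hint 5 (by norm_num)]
    simp only [intervalIntegral.integral_const, Complex.real_smul]
    field_simp
    push_cast
    ring
  all_goals first
    | exact hic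
    | exact hi _ _
    | (refine Continuous.intervalIntegrable ?_ _ _; fun_prop)

/-! ### Connecting two logarithms of velocities -/

theorem continuous_restrict_unitInterval (f : ℝ → ℝ → ℂ)
    (hf : Continuous fun q : ℝ × ℝ ↦ f q.1 q.2) :
    Continuous fun q : unitInterval × ℝ ↦ f q.1 q.2 :=
  hf.comp ((continuous_subtype_val.comp continuous_fst).prodMk continuous_snd)

set_option maxHeartbeats 400000 in
/-- Without leaving the space, the direction can be made to turn with constant angular velocity
through two full circles in any sufficiently short interval near `a`. The displacement changes by
`O(δ)`, which is compensated by a vector of the same size added to the velocity in the right half of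
`[a, b]`, where it is too small to make the velocity vanish. -/
theorem exists_joinedIn_eq_ramp {a b : ℝ} (hab : a < b) {D : ℂ} {α β : ℝ} {L : C(ℝ, ℂ)}
    (hL : L ∈ logVelocitySpace a b D α β) :
    ∃ δ₀ > 0, ∀ δ, 0 < δ → δ < δ₀ → ∃ L' : C(ℝ, ℂ), JoinedIn (logVelocitySpace a b D α β) L L' ∧
      ∀ u, |u - (a + 2 * δ)| ≤ δ → L' u = ramp (a + 2 * δ) δ u * Complex.I := by
  obtain ⟨hD, hα, hβ⟩ := hL
  set m := (a + b) / 2 with hm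
  have ham : a < m := by rw [hm]; linarith
  have hmb : m < b := by rw [hm]; linarith
  -- a speed profile `w` with integral `1`, supported in the right half of the interval
  obtain ⟨w, hwc, hwint, hwsupp⟩ : ∃ w : ℝ → ℝ, Continuous w ∧ ∫ u in a..b, w u = 1 ∧
      ∀ u, u ∉ Ioo m b → w u = 0 := by
    set w₀ : ℝ → ℝ := fun u ↦ max 0 ((u - m) * (b - u)) with hw₀
    have hc : Continuous w₀ := by simp only [hw₀]; fun_prop
    have hpos : 0 < ∫ u in a..b, w₀ u := by
      refine intervalIntegral.integral_pos hab hc.continuousOn (fun u _ ↦ le_max_left _ _)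
        ⟨(m + b) / 2, ⟨by linarith, by linarith⟩, ?_⟩
      exact lt_max_of_lt_right (mul_pos (by linarith) (by linarith))
    refine ⟨fun u ↦ (∫ u in a..b, w₀ u)⁻¹ * w₀ u, by fun_prop, ?_, fun u hu ↦ ?_⟩
    · rw [intervalIntegral.integral_const_mul, inv_mul_cancel₀ hpos.ne']
    · have : w₀ u = 0 := by
        refine max_eq_left ?_
        by_contra! h
        apply hu
        rcases pos_and_pos_or_neg_and_neg_of_mul_pos h with h' | h'
        · exact ⟨by linarith, by linarith⟩
        · linarith
      simp [this]
  obtain ⟨B, hB⟩ : ∃ B, ∀ u ∈ Icc a b, ‖L u‖ ≤ B :=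
    isCompact_Icc.exists_bound_of_continuousOn L.continuous.continuousOn
  obtain ⟨W, hW⟩ : ∃ W, ∀ u ∈ Icc a b, ‖w u‖ ≤ W :=
    isCompact_Icc.exists_bound_of_continuousOn hwc.continuousOn
  have hW0 : 0 ≤ W := (norm_nonneg _).trans (hW a ⟨le_rfl, hab.le⟩)
  have hB0 : 0 ≤ B := (norm_nonneg _).trans (hB a ⟨le_rfl, hab.le⟩)
  set C : ℝ := 8 * Real.exp B * (W * Real.exp B) + 1 with hC
  have hC0 : 0 < C := by positivity
  refine ⟨min ((b - a) / 8) (1 / C), lt_min (by linarith) (by positivity), fun δ hδ hδ₀ ↦ ?_⟩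
  have hδ1 : 8 * δ < b - a := by have := hδ₀.trans_le (min_le_left _ _); linarith
  have hδ2 : C * δ < 1 := by
    have := hδ₀.trans_le (min_le_right _ _)
    rwa [lt_div_iff₀ hC0, mul_comm] at this
  set c := a + 2 * δ with hc
  set η : ℝ → ℝ := fun u ↦ max 0 (min 1 (2 - |u - c| / δ)) with hη
  have hηc : Continuous η := by simp only [hη]; fun_prop
  have hη0 : ∀ u, 0 ≤ η u := fun u ↦ le_max_left _ _
  have hη1 : ∀ u, η u ≤ 1 := fun u ↦ max_le zero_le_one (min_le_left _ _)
  have hηJ : ∀ u, |u - c| ≤ δ → η u = 1 := fun u hu ↦ by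
    have : |u - c| / δ ≤ 1 := (div_le_one hδ).2 hu
    simp only [hη]
    rw [min_eq_left (by linarith), max_eq_right zero_le_one]
  have hηz : ∀ u, 2 * δ ≤ |u - c| → η u = 0 := fun u hu ↦ by
    have : 2 ≤ |u - c| / δ := (le_div_iff₀ hδ).2 hu
    exact max_eq_left ((min_le_right _ _).trans (by linarith))
  have hηr : ∀ u, a + 4 * δ ≤ u → η u = 0 := fun u hu ↦
    hηz u ((by rw [hc]; linarith : 2 * δ ≤ u - c).trans (le_abs_self _))
  have hηa : η a = 0 := hηz a (by
    rw [hc, abs_sub_comm]; exact le_abs_self _ |>.trans' (by linarith))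
  -- the linear homotopy of logarithms, which changes `L` only near `a`
  set ℓ : ℝ → ℝ → ℂ := fun s u ↦
    L u + ((s * η u : ℝ) : ℂ) * (ramp c δ u * Complex.I - L u) with hℓ
  have hℓc : Continuous (fun q : ℝ × ℝ ↦ ℓ q.1 q.2) := by simp only [hℓ]; fun_prop
  have hℓr : ∀ s u, η u = 0 → ℓ s u = L u := fun s u hu ↦ by simp [hℓ, hu]
  have hre : ∀ s ∈ Icc (0 : ℝ) 1, ∀ u ∈ Icc a b, ‖Complex.exp (ℓ s u)‖ ≤ Real.exp B := by
    intro s hs u hu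
    rw [Complex.norm_exp]
    refine Real.exp_le_exp.2 ?_
    have h1 : (ℓ s u).re = (1 - s * η u) * (L u).re := by
      simp only [hℓ, Complex.add_re, Complex.re_ofReal_mul, Complex.sub_re, Complex.I_re]
      ring
    have h2 : 0 ≤ 1 - s * η u := by nlinarith [hs.1, hs.2, hη0 u, hη1 u]
    have h3 : 1 - s * η u ≤ 1 := by nlinarith [hs.1, hs.2, hη0 u, hη1 u]
    have h4 : (L u).re ≤ B := (Complex.re_le_norm _).trans (hB u hu)
    rw [h1]
    nlinarith
  -- the change of the displacement that it causes is of order `δ`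
  set E : ℝ → ℂ := fun s ↦ ∫ u in a..b, (Complex.exp (ℓ s u) - Complex.exp (L u)) with hE
  have hEc : Continuous E := by
    refine intervalIntegral.continuous_parametric_intervalIntegral_of_continuous' ?_ a b
    exact (hℓc.cexp).sub (by fun_prop)
  have hE0 : E 0 = 0 := by simp [hE, hℓ]
  have hcsub : ∀ s, Continuous fun u ↦ Complex.exp (ℓ s u) - Complex.exp (L u) := fun s ↦ by
    simp only [hℓ]; fun_prop
  have hEle : ∀ s ∈ Icc (0 : ℝ) 1, ‖E s‖ ≤ 8 * Real.exp B * δ := by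
    intro s hs
    have hsplit : E s = ∫ u in a..(a + 4 * δ), (Complex.exp (ℓ s u) - Complex.exp (L u)) := by
      rw [hE]
      simp only
      rw [← intervalIntegral.integral_add_adjacent_intervals (b := a + 4 * δ)
        ((hcsub s).intervalIntegrable _ _) ((hcsub s).intervalIntegrable _ _), add_eq_left]
      refine (intervalIntegral.integral_congr (g := fun _ ↦ 0) fun u hu ↦ ?_).trans (by simp)
      rw [uIcc_of_le (by linarith)] at hu
      simp [hℓr s u (hηr u hu.1)]
    rw [hsplit]
    refine (intervalIntegral.norm_integral_le_of_norm_le_const (C := 2 * Real.exp B)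
      fun u hu ↦ ?_).trans (le_of_eq ?_)
    · rw [uIoc_of_le (by linarith)] at hu
      have hu' : u ∈ Icc a b := ⟨hu.1.le, by linarith [hu.2]⟩
      refine (norm_sub_le _ _).trans ?_
      have h2 := hre 0 (by simp) u hu'
      have : ℓ 0 u = L u := by simp [hℓ]
      rw [this] at h2
      linarith [hre s hs u hu']
    · rw [abs_of_pos (by linarith)]; ring
  set g : ℝ → ℝ → ℂ := fun s u ↦ E s * (w u : ℂ) * Complex.exp (-ℓ s u) with hg
  have hgz : ∀ s u, u ∉ Ioo m b → g s u = 0 := fun s u hu ↦ by simp [hg, hwsupp u hu]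
  have hglt : ∀ s ∈ Icc (0 : ℝ) 1, ∀ u, ‖g s u‖ < 1 := by
    intro s hs u
    by_cases hu : u ∈ Ioo m b
    · have hu' : u ∈ Icc a b := ⟨by linarith [hu.1], hu.2.le⟩
      have h1 : ℓ s u = L u := hℓr s u (hηr u (by rw [hm] at hu; linarith [hu.1]))
      have h2 : ‖Complex.exp (-ℓ s u)‖ ≤ Real.exp B := by
        rw [h1, Complex.norm_exp]
        refine Real.exp_le_exp.2 ?_
        have := (Complex.re_le_norm (-L u)).trans_eq (norm_neg _)
        exact this.trans (hB u hu')
      have h3 : ‖(w u : ℂ)‖ ≤ W := by simpa using hW u hu'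
      simp only [hg, norm_mul]
      calc ‖E s‖ * ‖(w u : ℂ)‖ * ‖Complex.exp (-ℓ s u)‖
          ≤ (8 * Real.exp B * δ) * W * Real.exp B := by
            gcongr
            exact hEle s hs
        _ ≤ C * δ := by rw [hC]; nlinarith
        _ < 1 := hδ2
    · simp [hgz s u hu]
  have hslit : ∀ s ∈ Icc (0 : ℝ) 1, ∀ u, 1 - g s u ∈ Complex.slitPlane := by
    intro s hs u
    left
    have := (Complex.re_le_norm (g s u)).trans_lt (hglt s hs u)
    simpa using this
  have hgc : Continuous (fun q : ℝ × ℝ ↦ g q.1 q.2) := by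
    simp only [hg]
    exact ((hEc.comp continuous_fst).mul (by fun_prop)).mul hℓc.neg.cexp
  set H : unitInterval × ℝ → ℂ := fun q ↦ ℓ q.1 q.2 + Complex.log (1 - g q.1 q.2) with hH
  have hHc : Continuous H := by
    refine (continuous_restrict_unitInterval ℓ hℓc).add
      (Continuous.clog ?_ fun q ↦ hslit _ q.1.2 _)
    exact continuous_const.sub (continuous_restrict_unitInterval g hgc)
  have hHz : ∀ t u, u ∉ Ioo m b → H (t, u) = ℓ t u := fun t u hu ↦ by simp [hH, hgz _ u hu]
  refine ⟨⟨fun u ↦ H (1, u), hHc.comp (Continuous.prodMk_right 1)⟩,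
    joinedIn_logVelocitySpace_of_homotopy (H := H) hHc (fun u ↦ ?_) (fun u ↦ rfl) (fun t ↦ ?_)
      (fun t ↦ ?_) (fun t ↦ ?_), fun u hu ↦ ?_⟩
  · simp [hH, hg, hE0, hℓ]
  · have hexp : ∀ u, Complex.exp (H (t, u)) =
        (Complex.exp (ℓ t u) - Complex.exp (L u)) + Complex.exp (L u) - E t * (w u : ℂ) := by
      intro u
      simp only [hH]
      rw [Complex.exp_add, Complex.exp_log (Complex.slitPlane_ne_zero (hslit _ t.2 _))]
      simp only [hg, Complex.exp_neg]
      have := Complex.exp_ne_zero (ℓ t u)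
      field_simp
      ring
    simp_rw [hexp]
    have i1 := (hcsub t).intervalIntegrable (μ := MeasureTheory.volume) a b
    have i2 : IntervalIntegrable (fun u ↦ Complex.exp (L u)) MeasureTheory.volume a b :=
      (by fun_prop : Continuous fun u ↦ Complex.exp (L u)).intervalIntegrable _ _
    have i3 : IntervalIntegrable (fun u ↦ E t * (w u : ℂ)) MeasureTheory.volume a b :=
      (by fun_prop : Continuous fun u ↦ E t * (w u : ℂ)).intervalIntegrable _ _
    rw [intervalIntegral.integral_sub (i1.add i2) i3, intervalIntegral.integral_add i1 i2, hD,
      intervalIntegral.integral_const_mul, intervalIntegral.integral_ofReal, hwint]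
    simp [hE]
  · rw [hHz t a (by simp [ham.le]), hℓr _ _ hηa, hα]
  · rw [hHz t b (by simp), hℓr _ _ (hηr b (by linarith)), hβ]
  · have hu' : u ∉ Ioo m b := fun h ↦ by
      have := (le_abs_self _).trans hu
      rw [hc] at this; rw [hm] at h; linarith [h.1]
    simp only [ContinuousMap.coe_mk]
    rw [hHz 1 u hu']
    simp [hℓ, hηJ u hu]

set_option maxHeartbeats 400000 in
/-- If two logarithms agree on an interval where the direction runs through two full circles, then
the linear homotopy between them can be corrected by an increase of the speed on this interval. At
the two ends of the homotopy there is nothing to correct. -/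
theorem joinedIn_of_eq_ramp {a b : ℝ} {D : ℂ} {α β δ : ℝ} (hδ : 0 < δ)
    (hδb : a + 3 * δ ≤ b) {L₁ L₂ : C(ℝ, ℂ)}
    (hL₁ : L₁ ∈ logVelocitySpace a b D α β) (hL₂ : L₂ ∈ logVelocitySpace a b D α β)
    (h₁ : ∀ u, |u - (a + 2 * δ)| ≤ δ → L₁ u = ramp (a + 2 * δ) δ u * Complex.I)
    (h₂ : ∀ u, |u - (a + 2 * δ)| ≤ δ → L₂ u = ramp (a + 2 * δ) δ u * Complex.I) :
    JoinedIn (logVelocitySpace a b D α β) L₁ L₂ := by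
  obtain ⟨hD₁, hα₁, hβ₁⟩ := hL₁
  obtain ⟨hD₂, hα₂, hβ₂⟩ := hL₂
  set c := a + 2 * δ with hc
  set ℓ : ℝ → ℝ → ℂ := fun t u ↦ (1 - t : ℝ) * L₁ u + (t : ℝ) * L₂ u with hℓ
  have hℓc : Continuous (Function.uncurry ℓ) := by
    simp only [hℓ, Function.uncurry_def]; fun_prop
  have hℓJ : ∀ t u, |u - c| ≤ δ → ℓ t u = ramp c δ u * Complex.I := fun t u hu ↦ by
    simp only [hℓ, h₁ u hu, h₂ u hu]; push_cast; ring
  -- the weight of the speed on the ramp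
  set κ : ℝ → ℝ := fun u ↦ 1 + Real.cos (Real.pi * max (-1) (min 1 ((u - c) / δ))) with hκ
  have hκc : Continuous κ := by simp only [hκ]; fun_prop
  have hκ0 : ∀ u, 0 ≤ κ u := fun u ↦ by
    have := Real.neg_one_le_cos (Real.pi * max (-1) (min 1 ((u - c) / δ)))
    simp only [hκ]; linarith
  have hκl : ∀ u, u ≤ c - δ → κ u = 0 := fun u hu ↦ by
    have : (u - c) / δ ≤ -1 := by rw [div_le_iff₀ hδ]; linarith
    simp only [hκ]
    rw [max_eq_left ((min_le_right _ _).trans this)]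
    simp
  have hκr : ∀ u, c + δ ≤ u → κ u = 0 := fun u hu ↦ by
    have : 1 ≤ (u - c) / δ := by rw [le_div_iff₀ hδ]; linarith
    simp only [hκ]
    rw [min_eq_left this]
    simp
  have hκJ : ∀ u, |u - c| ≤ δ → κ u = 1 + Real.cos (Real.pi * ((u - c) / δ)) := fun u hu ↦ by
    rw [abs_le] at hu
    have h1 : (u - c) / δ ≤ 1 := by rw [div_le_iff₀ hδ]; linarith
    have h2 : -1 ≤ (u - c) / δ := by rw [le_div_iff₀ hδ]; linarith
    simp only [hκ, min_eq_right h1, max_eq_right h2]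
  set E : ℝ → ℂ := fun t ↦ D - ∫ u in a..b, Complex.exp (ℓ t u) with hE
  have hEc : Continuous E := by
    refine continuous_const.sub ?_
    exact intervalIntegral.continuous_parametric_intervalIntegral_of_continuous' hℓc.cexp a b
  set A : ℝ → ℝ → ℝ := fun t u ↦
    κ u * (‖E t‖ + (E t * Complex.exp (-(ramp c δ u * Complex.I))).re) / δ with hA
  have hAc : Continuous (Function.uncurry A) := by
    simp only [hA, Function.uncurry_def]
    refine Continuous.div_const ((hκc.comp continuous_snd).mul
      (((hEc.comp continuous_fst).norm).add (Complex.continuous_re.comp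
        ((hEc.comp continuous_fst).mul ?_)))) _
    fun_prop
  have hA0 : ∀ t u, 0 ≤ A t u := fun t u ↦ by
    refine div_nonneg (mul_nonneg (hκ0 u) ?_) hδ.le
    have h1 := (abs_le.1 (Complex.abs_re_le_norm
      (E t * Complex.exp (-(ramp c δ u * Complex.I))))).1
    have h2 : ‖Complex.exp (-(ramp c δ u * Complex.I))‖ = 1 := by
      rw [← neg_mul, ← Complex.ofReal_neg, Complex.norm_exp_ofReal_mul_I]
    rw [norm_mul, h2, mul_one] at h1
    linarith
  have hAint : ∀ t, ∫ u in a..b, (A t u : ℂ) * Complex.exp (ℓ t u) = E t := by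
    intro t
    have hcont : Continuous fun u ↦ (A t u : ℂ) * Complex.exp (ℓ t u) := by
      have h1 : Continuous (A t) := hAc.uncurry_left t
      have h2 : Continuous (ℓ t) := hℓc.uncurry_left t
      exact (Complex.continuous_ofReal.comp h1).mul h2.cexp
    have hi : ∀ x y, IntervalIntegrable (fun u ↦ (A t u : ℂ) * Complex.exp (ℓ t u))
        MeasureTheory.volume x y := fun x y ↦ hcont.intervalIntegrable x y
    rw [← intervalIntegral.integral_add_adjacent_intervals (hi a (c - δ)) (hi _ b),
      ← intervalIntegral.integral_add_adjacent_intervals (hi (c - δ) (c + δ)) (hi _ b)]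
    rw [intervalIntegral.integral_congr (b := c - δ) (g := fun _ ↦ 0),
      intervalIntegral.integral_congr (a := c + δ) (g := fun _ ↦ 0),
      intervalIntegral.integral_congr (a := c - δ) (g := fun u ↦
        ((((1 + Real.cos (Real.pi * ((u - c) / δ))) *
        (‖E t‖ + (E t * Complex.exp (-(ramp c δ u * Complex.I))).re) / δ : ℝ) : ℂ) *
        Complex.exp (ramp c δ u * Complex.I))), integral_speed_mul_exp_ramp hδ]
    · simp
    · intro u hu
      rw [uIcc_of_le (by linarith)] at hu
      have hu' : |u - c| ≤ δ := abs_le.2 ⟨by linarith [hu.1], by linarith [hu.2]⟩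
      simp only [hA, hκJ u hu', hℓJ t u hu']
    · intro u hu
      rw [uIcc_of_le (by linarith)] at hu
      simp [hA, hκr u hu.1]
    · intro u hu
      rw [uIcc_of_le (by linarith)] at hu
      simp [hA, hκl u hu.2]
  have hE0 : E 0 = 0 := by simp [hE, hℓ, hD₁]
  have hE1 : E 1 = 0 := by simp [hE, hℓ, hD₂]
  set H : unitInterval × ℝ → ℂ := fun q ↦ ℓ q.1 q.2 + (Real.log (1 + A q.1 q.2) : ℝ) with hH
  have hHim : ∀ t u, (H (t, u)).im = (1 - t) * (L₁ u).im + t * (L₂ u).im := fun t u ↦ by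
    simp only [hH, hℓ, Complex.add_im, Complex.ofReal_im, Complex.im_ofReal_mul, add_zero]
  refine joinedIn_logVelocitySpace_of_homotopy (H := H) ?_ (fun u ↦ ?_) (fun u ↦ ?_) (fun t ↦ ?_)
    (fun t ↦ ?_) (fun t ↦ ?_)
  · refine continuous_restrict_unitInterval (fun t u ↦ ℓ t u + (Real.log (1 + A t u) : ℝ))
      (hℓc.add (Complex.continuous_ofReal.comp ?_))
    exact (continuous_const.add hAc).log fun q ↦ (by
      have := hA0 q.1 q.2
      exact (by linarith : 0 < 1 + A q.1 q.2).ne')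
  · simp [hH, hA, hE0, hℓ]
  · simp [hH, hA, hE1, hℓ]
  · have hexp : ∀ u, Complex.exp (H (t, u)) =
        Complex.exp (ℓ t u) + (A t u : ℂ) * Complex.exp (ℓ t u) := by
      intro u
      have : (0 : ℝ) < 1 + A t u := by have := hA0 t u; positivity
      simp only [hH]
      rw [Complex.exp_add, ← Complex.ofReal_exp, Real.exp_log this]
      push_cast; ring
    have h1 : Continuous (A t) := hAc.uncurry_left (t : ℝ)
    have h2 : Continuous (ℓ t) := hℓc.uncurry_left (t : ℝ)
    simp_rw [hexp]
    rw [intervalIntegral.integral_add, hAint]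
    · simp [hE]
    · exact h2.cexp.intervalIntegrable _ _
    · exact ((Complex.continuous_ofReal.comp h1).mul h2.cexp).intervalIntegrable _ _
  · rw [hHim, hα₁, hα₂]; ring
  · rw [hHim, hβ₁, hβ₂]; ring

theorem joinedIn_logVelocitySpace {a b : ℝ} (hab : a < b) {D : ℂ} {α β : ℝ} {L₁ L₂ : C(ℝ, ℂ)}
    (hL₁ : L₁ ∈ logVelocitySpace a b D α β) (hL₂ : L₂ ∈ logVelocitySpace a b D α β) :
    JoinedIn (logVelocitySpace a b D α β) L₁ L₂ := by
  obtain ⟨δ₁, hδ₁, h₁⟩ := exists_joinedIn_eq_ramp hab hL₁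
  obtain ⟨δ₂, hδ₂, h₂⟩ := exists_joinedIn_eq_ramp hab hL₂
  obtain ⟨δ, hδ, hδlt⟩ : ∃ δ, 0 < δ ∧ δ < min (min δ₁ δ₂) ((b - a) / 3) :=
    exists_between (lt_min (lt_min hδ₁ hδ₂) (by linarith))
  simp only [lt_min_iff] at hδlt
  obtain ⟨L₁', hj₁, he₁⟩ := h₁ δ hδ hδlt.1.1
  obtain ⟨L₂', hj₂, he₂⟩ := h₂ δ hδ hδlt.1.2
  exact hj₁.trans ((joinedIn_of_eq_ramp hδ (by linarith [hδlt.2]) hj₁.target_mem hj₂.target_mem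
    he₁ he₂).trans hj₂.symm)

/-! ### Regular homotopies of plane curves -/

/-- The identification of the euclidean plane with the complex plane. -/
noncomputable def planeEquivComplex : Plane ≃ₗᵢ[ℝ] ℂ := Complex.orthonormalBasisOneI.repr.symm

theorem planeEquivComplex_symm_apply (z : ℂ) : planeEquivComplex.symm z = !₂[z.re, z.im] := by
  ext i
  simp [planeEquivComplex]

/-- A continuous angle that is constant modulo `2π` on a preconnected set is constant there. -/
theorem angle_const_of_isPreconnected {X : Type*} [TopologicalSpace X] {S : Set X}
    (hS : IsPreconnected S) {f : X → ℝ} (hf : ContinuousOn f S)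
    (he : ∀ x ∈ S, ∀ y ∈ S, Complex.exp (f x * Complex.I) = Complex.exp (f y * Complex.I))
    {x y : X} (hx : x ∈ S) (hy : y ∈ S) : f x = f y := by
  have hc := Circle.isCoveringMap_exp
  refine hc.isSeparatedMap.constOn_of_comp hc.isLocalHomeomorph.isLocallyInjective hS hf
    (fun x hx y hy ↦ ?_) hx hy
  exact Circle.ext (by simpa using he x hx y hy)

theorem isAngleFunction_im_of_exp_eq {a b : ℝ} {c : ℝ → Plane} {L : ℝ → ℂ}
    (hL : ContinuousOn L (Icc a b))
    (hexp : ∀ u ∈ Icc a b, planeEquivComplex (planeVelocity a b c u) = Complex.exp (L u)) :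
    IsAngleFunction a b c (fun u ↦ (L u).im) := by
  refine ⟨Complex.continuous_im.comp_continuousOn hL, fun u hu ↦ ?_⟩
  have h1 : planeVelocity a b c u = planeEquivComplex.symm (Complex.exp (L u)) := by
    rw [← hexp u hu, LinearIsometryEquiv.symm_apply_apply]
  have h2 : ‖planeVelocity a b c u‖ = Real.exp (L u).re := by
    rw [h1, LinearIsometryEquiv.norm_map, Complex.norm_exp]
  rw [planeDirection, h2, h1, planeEquivComplex_symm_apply, Complex.exp_re, Complex.exp_im]
  have := (Real.exp_pos (L u).re).ne'
  ext i
  fin_cases i <;> simp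

theorem iIndex_eq_of_exp_eq {a b : ℝ} (hab : a ≤ b) {c : ℝ → Plane} {L : ℝ → ℂ}
    (hL : ContinuousOn L (Icc a b))
    (hexp : ∀ u ∈ Icc a b, planeEquivComplex (planeVelocity a b c u) = Complex.exp (L u)) :
    iIndex a b c = ((L b).im - (L a).im) / (2 * Real.pi) := by
  have hθ := isAngleFunction_im_of_exp_eq hL hexp
  have hex : ∃ θ : ℝ → ℝ, IsAngleFunction a b c θ := ⟨_, hθ⟩
  rw [iIndex, dif_pos hex]
  set θ' := hex.choose
  have hθ' : IsAngleFunction a b c θ' := hex.choose_spec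
  have key : ∀ u ∈ Icc a b, Complex.exp (((θ' u - (L u).im : ℝ) : ℂ) * Complex.I) = 1 := by
    intro u hu
    have h := (hθ'.direction_eq u hu).symm.trans (hθ.direction_eq u hu)
    have h0 := congrArg (fun p : Plane ↦ p 0) h
    have h1 := congrArg (fun p : Plane ↦ p 1) h
    simp at h0 h1
    have : Complex.exp ((θ' u : ℂ) * Complex.I) = Complex.exp (((L u).im : ℂ) * Complex.I) := by
      rw [Complex.exp_mul_I, Complex.exp_mul_I]
      norm_cast
      rw [h0, h1]
    push_cast
    rw [sub_mul, Complex.exp_sub, this, div_self (Complex.exp_ne_zero _)]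
  have := angle_const_of_isPreconnected (f := fun u ↦ θ' u - (L u).im) isPreconnected_Icc
    (hθ'.continuousOn.sub hθ.continuousOn)
    (fun x hx y hy ↦ (key x hx).trans (key y hy).symm) (left_mem_Icc.2 hab) (right_mem_Icc.2 hab)
  congr 1
  linarith

/-- A nowhere vanishing function on a retract `S` of a simply connected space has a continuous
logarithm. -/
theorem exists_continuous_log_of_retraction {X : Type*} [TopologicalSpace X]
    [SimplyConnectedSpace X] [LocallyPathConnectedSpace X] {S : Set X} {r : X → X}
    (hr : Continuous r) (hrS : ∀ x, r x ∈ S) (hrid : ∀ x ∈ S, r x = x) {V : X → ℂ}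
    (hV : ContinuousOn V S) (hV0 : ∀ x ∈ S, V x ≠ 0) :
    ∃ L : C(X, ℂ), ∀ x ∈ S, Complex.exp (L x) = V x := by
  have hg : Continuous (V ∘ r) := hV.comp_continuous hr hrS
  have x₀ : X := Classical.arbitrary X
  obtain ⟨f, ⟨-, hf⟩, -⟩ := Complex.isCoveringMapOn_exp.existsUnique_continuousMap_lifts
    ⟨V ∘ r, hg⟩ (a₀ := x₀) (e₀ := Complex.log (V (r x₀))) (Complex.exp_log (hV0 _ (hrS _)))
    (fun x ↦ hV0 _ (hrS _))
  refine ⟨f, fun x hx ↦ ?_⟩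
  have := congrFun hf x
  simpa [hrid x hx] using this

theorem exists_continuous_log {a b : ℝ} (hab : a ≤ b) {V : ℝ → ℂ} (hV : ContinuousOn V (Icc a b))
    (hV0 : ∀ u ∈ Icc a b, V u ≠ 0) : ∃ L : C(ℝ, ℂ), ∀ u ∈ Icc a b, Complex.exp (L u) = V u :=
  exists_continuous_log_of_retraction (r := fun u ↦ (projIcc a b hab u : ℝ))
    (continuous_subtype_val.comp continuous_projIcc) (fun u ↦ (projIcc a b hab u).2)
    (fun u hu ↦ by rw [projIcc_of_mem hab hu]) hV hV0

/-- A regular `C¹` curve is recovered from the logarithm of its velocity. -/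
theorem integral_exp_eq_of_velocity {a b : ℝ} {c : ℝ → Plane}
    (hc : ContDiffOn ℝ 1 c (Icc a b)) {L : C(ℝ, ℂ)}
    (hexp : ∀ u ∈ Icc a b, Complex.exp (L u) = planeEquivComplex (planeVelocity a b c u))
    {u : ℝ} (hu : u ∈ Icc a b) :
    ∫ s in a..u, Complex.exp (L s) = planeEquivComplex (c u) - planeEquivComplex (c a) := by
  have hd := hc.differentiableOn one_ne_zero
  have hsub : Icc a u ⊆ Icc a b := Icc_subset_Icc_right hu.2
  refine intervalIntegral.integral_eq_sub_of_hasDerivAt_of_le (f := fun s ↦ planeEquivComplex (c s))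
    hu.1 (planeEquivComplex.continuous.comp_continuousOn (hc.continuousOn.mono hsub))
    (fun s hs ↦ ?_) ((by fun_prop : Continuous fun s ↦ Complex.exp (L s)).intervalIntegrable _ _)
  have hs' : s ∈ Icc a b := hsub (Ioo_subset_Icc_self hs)
  have h1 : HasDerivAt c (planeVelocity a b c s) s :=
    (hd s hs').hasDerivWithinAt.hasDerivAt (Icc_mem_nhds hs.1 (hs.2.trans_le hu.2))
  rw [hexp s hs']
  exact planeEquivComplex.toContinuousLinearEquiv.toContinuousLinearMap.hasFDerivAt.comp_hasDerivAt
    s h1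

/-- The relative Whitney–Graustein theorem in the plane: regular curves with the same end points,
the same initial direction and the same index are joined by a family of regular curves with the
same end points and the same directions there. The family is given together with its velocities
`V`, and consists of curves that are defined and regular on the whole line. -/
theorem exists_planar_regular_homotopy {a b : ℝ} (hab : a < b) {c₁ c₂ : ℝ → Plane}
    (hc₁ : ContDiffOn ℝ 1 c₁ (Icc a b)) (hc₂ : ContDiffOn ℝ 1 c₂ (Icc a b))
    (hv₁ : ∀ u ∈ Icc a b, planeVelocity a b c₁ u ≠ 0)
    (hv₂ : ∀ u ∈ Icc a b, planeVelocity a b c₂ u ≠ 0)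
    (ha : c₁ a = c₂ a) (hb : c₁ b = c₂ b)
    (hdir : ∃ k : ℝ, 0 < k ∧ planeVelocity a b c₂ a = k • planeVelocity a b c₁ a)
    (hindex : iIndex a b c₁ = iIndex a b c₂) :
    ∃ C V : ℝ → ℝ → Plane, Continuous (Function.uncurry C) ∧ Continuous (Function.uncurry V) ∧
      (∀ t u, HasDerivAt (C t) (V t u) u) ∧ (∀ t u, V t u ≠ 0) ∧
      (∀ t, C t a = c₁ a) ∧ (∀ t, C t b = c₁ b) ∧
      (∀ t, ∃ k : ℝ, 0 < k ∧ V t a = k • planeVelocity a b c₁ a) ∧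
      (∀ t, ∃ k : ℝ, 0 < k ∧ V t b = k • planeVelocity a b c₁ b) ∧
      EqOn (C 0) c₁ (Icc a b) ∧ EqOn (C 1) c₂ (Icc a b) := by
  have haI : a ∈ Icc a b := left_mem_Icc.2 hab.le
  have hbI : b ∈ Icc a b := right_mem_Icc.2 hab.le
  have hlog : ∀ c : ℝ → Plane, ContDiffOn ℝ 1 c (Icc a b) →
      (∀ u ∈ Icc a b, planeVelocity a b c u ≠ 0) → ∃ L : C(ℝ, ℂ), ∀ u ∈ Icc a b,
        Complex.exp (L u) = planeEquivComplex (planeVelocity a b c u) := fun c hc hv ↦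
    exists_continuous_log hab.le (V := fun u ↦ planeEquivComplex (planeVelocity a b c u))
      (planeEquivComplex.continuous.comp_continuousOn
        (hc.continuousOn_derivWithin (uniqueDiffOn_Icc hab) le_rfl))
      (fun u hu ↦ by simpa using hv u hu)
  obtain ⟨L₁, hL₁⟩ := hlog c₁ hc₁ hv₁
  obtain ⟨L₂, hL₂⟩ := hlog c₂ hc₂ hv₂
  obtain ⟨k, hk, hdir⟩ := hdir
  -- a multiple of `2πi` is added to `L₂`, so that the angles at `a` agree
  obtain ⟨n, hn⟩ : ∃ n : ℤ, L₂ a = (Real.log k : ℝ) + L₁ a + n * (2 * Real.pi * Complex.I) := by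
    rw [← Complex.exp_eq_exp_iff_exists_int, Complex.exp_add, hL₁ a haI, hL₂ a haI, hdir,
      ← Complex.ofReal_exp, Real.exp_log hk]
    simp
  set L₂' : C(ℝ, ℂ) := ⟨fun u ↦ L₂ u - n * (2 * Real.pi * Complex.I), by fun_prop⟩ with hL₂'
  have hexp₂' : ∀ u ∈ Icc a b,
      Complex.exp (L₂' u) = planeEquivComplex (planeVelocity a b c₂ u) := fun u hu ↦ by
    simp only [hL₂', ContinuousMap.coe_mk]
    rw [Complex.exp_sub, Complex.exp_int_mul_two_pi_mul_I, div_one, hL₂ u hu]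
  have hima : (L₂' a).im = (L₁ a).im := by simp [hL₂', hn]
  rw [iIndex_eq_of_exp_eq hab.le L₁.continuous.continuousOn fun u hu ↦ (hL₁ u hu).symm,
    iIndex_eq_of_exp_eq hab.le L₂'.continuous.continuousOn fun u hu ↦ (hexp₂' u hu).symm,
    div_left_inj' (by positivity), hima, sub_left_inj] at hindex
  set D := planeEquivComplex (c₁ b) - planeEquivComplex (c₁ a) with hD
  have hF₁ : L₁ ∈ logVelocitySpace a b D (L₁ a).im (L₁ b).im :=
    ⟨integral_exp_eq_of_velocity hc₁ hL₁ hbI, rfl, rfl⟩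
  have hF₂ : L₂' ∈ logVelocitySpace a b D (L₁ a).im (L₁ b).im :=
    ⟨by rw [integral_exp_eq_of_velocity hc₂ hexp₂' hbI, ← ha, ← hb], hima, hindex.symm⟩
  obtain ⟨P, hP⟩ := joinedIn_logVelocitySpace hab hF₁ hF₂
  have hPF : ∀ t, P.extend t ∈ logVelocitySpace a b D (L₁ a).im (L₁ b).im := fun t ↦ hP _
  have hPc : Continuous fun q : ℝ × ℝ ↦ P.extend q.1 q.2 := by
    have := P.extend.continuous
    fun_prop
  set W : ℝ → ℝ → ℂ := fun t u ↦ Complex.exp (P.extend t u) with hW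
  have hWc : Continuous (Function.uncurry W) := hPc.cexp
  have hscale : ∀ (L : C(ℝ, ℂ)) (u : ℝ), u ∈ Icc a b → (L u).im = (L₁ u).im →
      ∃ k : ℝ, 0 < k ∧
        planeEquivComplex.symm (Complex.exp (L u)) = k • planeVelocity a b c₁ u := by
    intro L u hu him
    refine ⟨Real.exp ((L u).re - (L₁ u).re), Real.exp_pos _, ?_⟩
    rw [LinearIsometryEquiv.symm_apply_eq, map_smul, ← hL₁ u hu, Complex.real_smul,
      Complex.ofReal_exp, ← Complex.exp_add]
    congr 1
    apply Complex.ext <;> simp [him]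
  have hEq : ∀ (c : ℝ → Plane) (L : C(ℝ, ℂ)), ContDiffOn ℝ 1 c (Icc a b) → c₁ a = c a →
      (∀ u ∈ Icc a b, Complex.exp (L u) = planeEquivComplex (planeVelocity a b c u)) →
      EqOn (fun u ↦ c₁ a + planeEquivComplex.symm (∫ s in a..u, Complex.exp (L s))) c
        (Icc a b) := by
    intro c L hc hca hL u hu
    simp only
    rw [integral_exp_eq_of_velocity hc hL hu, hca]
    simp
  refine ⟨fun t u ↦ c₁ a + planeEquivComplex.symm (∫ s in a..u, W t s),
    fun t u ↦ planeEquivComplex.symm (W t u), ?_, ?_, fun t u ↦ ?_, fun t u ↦ ?_, fun t ↦ ?_,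
    fun t ↦ ?_, fun t ↦ ?_, fun t ↦ ?_, ?_, ?_⟩
  · refine continuous_const.add (planeEquivComplex.symm.continuous.comp ?_)
    refine intervalIntegral.continuous_parametric_intervalIntegral_of_continuous
      (f := fun q : ℝ × ℝ ↦ W q.1) (s := Prod.snd) ?_ continuous_snd
    exact hWc.comp ((continuous_fst.comp continuous_fst).prodMk continuous_snd)
  · exact planeEquivComplex.symm.continuous.comp hWc
  · have h1 : HasDerivAt (fun u ↦ ∫ s in a..u, W t s) (W t u) u :=
      intervalIntegral.integral_hasDerivAt_right
        ((hWc.uncurry_left t).intervalIntegrable _ _)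
        ((hWc.uncurry_left t).stronglyMeasurableAtFilter _ _) (hWc.uncurry_left t).continuousAt
    exact (planeEquivComplex.symm.toContinuousLinearEquiv.toContinuousLinearMap.hasFDerivAt
      |>.comp_hasDerivAt u h1).const_add _
  · simp [hW, Complex.exp_ne_zero]
  · simp
  · have := (hPF t).1
    simp only [hW, this, hD]
    simp
  · exact hscale _ a haI (hPF t).2.1
  · exact hscale _ b hbI (hPF t).2.2
  · simpa [hW] using hEq c₁ L₁ hc₁ rfl hL₁
  · simpa [hW] using hEq c₂ L₂' hc₂ ha hexp₂'

/-! ### Velocities and lifts -/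

section Velocity

variable {M : Type*} [TopologicalSpace M] [ChartedSpace Plane M]

theorem velocity_comp {M' : Type*} [TopologicalSpace M'] [ChartedSpace Plane M'] {a b : ℝ}
    (hab : a < b) {γ : ℝ → M} {f : M → M'} {u : ℝ} (hu : u ∈ Icc a b)
    (hf : MDifferentiableAt (𝓡 2) (𝓡 2) f (γ u))
    (hγ : MDifferentiableWithinAt 𝓘(ℝ, ℝ) (𝓡 2) γ (Icc a b) u) :
    velocity a b (f ∘ γ) u = tangentMap (𝓡 2) (𝓡 2) f (velocity a b γ u) := by
  have h := mfderiv_comp_mfderivWithin u hf hγ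
    (uniqueMDiffWithinAt_iff_uniqueDiffWithinAt.2 (uniqueDiffOn_Icc hab u hu))
  simp only [velocity, tangentMap, h]
  rfl

theorem velocity_congr {a b : ℝ} {γ γ' : ℝ → M} {u : ℝ} (hu : u ∈ Icc a b)
    (h : γ =ᶠ[nhdsWithin u (Icc a b)] γ') : velocity a b γ u = velocity a b γ' u := by
  have hu' : γ u = γ' u := h.self_of_nhdsWithin hu
  have := h.mfderivWithin_eq (I := 𝓘(ℝ, ℝ)) (I' := 𝓡 2) hu'
  simp only [velocity]
  rw [this, hu']

theorem velocity_plane (a b : ℝ) (c : ℝ → Plane) (u : ℝ) :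
    velocity a b c u = ⟨c u, planeVelocity a b c u⟩ := by
  simp only [velocity, planeVelocity, mfderivWithin_eq_fderivWithin]
  rfl

theorem continuous_tangentBundle_plane_snd :
    Continuous (fun v : TangentBundle (𝓡 2) Plane ↦ (v.2 : Plane)) := by
  have := (tangentBundleModelSpaceHomeomorph (𝓡 2)).continuous
  exact (continuous_snd.comp this : _)

theorem continuous_tangentBundle_plane_mk {X : Type*} [TopologicalSpace X] {f g : X → Plane}
    (hf : Continuous f) (hg : Continuous g) :
    Continuous (fun x ↦ (⟨f x, g x⟩ : TangentBundle (𝓡 2) Plane)) := by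
  have := (tangentBundleModelSpaceHomeomorph (𝓡 2)).symm.continuous
  exact this.comp (hf.prodMk hg : Continuous fun x ↦ ((f x, g x) : ModelProd Plane Plane))

variable [RiemannianBundle (fun x : M ↦ TangentSpace (𝓡 2) x)]

/-- The direction, with its foot point, determines the velocity up to a positive factor. The
velocities are nonzero, which excludes the junk direction `0`. -/
theorem direction_eq_iff {a b : ℝ} {γ γ' : ℝ → M} {u u' : ℝ}
    (h : (velocity a b γ u).2 ≠ 0) (h' : (velocity a b γ' u').2 ≠ 0) :
    direction a b γ' u' = direction a b γ u ↔
      ∃ k : ℝ, 0 < k ∧ velocity a b γ' u' = ⟨γ u, k • (velocity a b γ u).2⟩ := by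
  have key : ∀ X Y : TangentBundle (𝓡 2) M, X.2 ≠ 0 → Y.2 ≠ 0 →
      (((⟨Y.1, ‖Y.2‖⁻¹ • Y.2⟩ : TangentBundle (𝓡 2) M) = ⟨X.1, ‖X.2‖⁻¹ • X.2⟩) ↔
        ∃ k : ℝ, 0 < k ∧ Y = ⟨X.1, k • X.2⟩) := by
    rintro ⟨x, v⟩ ⟨y, w⟩ hv hw
    simp only at hv hw ⊢
    have hv' : 0 < ‖v‖ := norm_pos_iff.2 hv
    have hw' : 0 < ‖w‖ := norm_pos_iff.2 hw
    constructor
    · intro h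
      obtain rfl : y = x := congrArg TotalSpace.proj h
      rw [TotalSpace.mk_inj] at h
      refine ⟨‖w‖ * ‖v‖⁻¹, by positivity, ?_⟩
      rw [TotalSpace.mk_inj, mul_smul, ← h, smul_smul, mul_inv_cancel₀ hw'.ne', one_smul]
    · rintro ⟨k, hk, h⟩
      obtain rfl : y = x := congrArg TotalSpace.proj h
      rw [TotalSpace.mk_inj] at h ⊢
      subst h
      rw [norm_smul, Real.norm_of_nonneg hk.le, smul_smul, mul_inv, mul_right_comm,
        inv_mul_cancel₀ hk.ne', one_mul]
  exact key (velocity a b γ u) (velocity a b γ' u') h h'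

end Velocity

section Development

variable {M : Type*} [TopologicalSpace M] [ChartedSpace Plane M]
  {Mt : Type*} [TopologicalSpace Mt]
  {pr : Mt → M} {φ : Mt → Plane}

/-- A map `g` from an open subset `W` of `M` to the plane is a branch, on the open subset `N` of
the cover, of the multivalued map `φ ∘ pr⁻¹`. -/
structure IsDevelopment (pr : Mt → M) (φ : Mt → Plane) (g : M → Plane) (W : Set M) (N : Set Mt) :
    Prop where
  isOpen_base : IsOpen W
  isOpen_cover : IsOpen N
  mapsTo : MapsTo pr N W
  comp_eq : EqOn (g ∘ pr) φ N
  isLocalDiffeomorphOn : IsLocalDiffeomorphOn (𝓡 2) (𝓡 2) ∞ g W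

namespace IsDevelopment

variable {g : M → Plane} {W : Set M} {N : Set Mt}

theorem mdifferentiableAt (h : IsDevelopment pr φ g W N) {x : M} (hx : x ∈ W) :
    MDifferentiableAt (𝓡 2) (𝓡 2) g x :=
  (h.isLocalDiffeomorphOn ⟨x, hx⟩).mdifferentiableAt (by simp)

theorem mfderiv_injective (h : IsDevelopment pr φ g W N) {x : M} (hx : x ∈ W) :
    Function.Injective (mfderiv (𝓡 2) (𝓡 2) g x) :=
  ((h.isLocalDiffeomorphOn ⟨x, hx⟩).mfderivToContinuousLinearEquiv (by simp)).injective

theorem continuousOn_tangentMap [IsManifold (𝓡 2) ∞ M] (h : IsDevelopment pr φ g W N) :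
    ContinuousOn (tangentMap (𝓡 2) (𝓡 2) g) (TotalSpace.proj ⁻¹' W) := by
  have : IsManifold (𝓡 2) 1 M := .of_le (n := ∞) (by simp)
  have h1 := (h.isLocalDiffeomorphOn.contMDiffOn).continuousOn_tangentMapWithin (by simp)
    h.isOpen_base.uniqueMDiffOn
  exact h1.congr fun v hv ↦ (tangentMapWithin_eq_tangentMap
    (h.isOpen_base.uniqueMDiffOn _ hv) (h.mdifferentiableAt hv)).symm

variable {a b : ℝ} {γ : ℝ → M} {γt : ℝ → Mt} {u : ℝ}

theorem comp_eventuallyEq (h : IsDevelopment pr φ g W N) (hu : u ∈ Icc a b)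
    (hγt : ContinuousOn γt (Icc a b)) (hlift : ∀ s ∈ Icc a b, pr (γt s) = γ s)
    (hN : γt u ∈ N) : φ ∘ γt =ᶠ[nhdsWithin u (Icc a b)] g ∘ γ := by
  filter_upwards [(hγt u hu) (h.isOpen_cover.mem_nhds hN), self_mem_nhdsWithin] with s hs hs'
  simp only [Function.comp_apply, ← hlift s hs']
  exact (h.comp_eq hs).symm

theorem contDiffWithinAt_comp (h : IsDevelopment pr φ g W N) (hu : u ∈ Icc a b)
    (hγ : ContMDiffOn 𝓘(ℝ, ℝ) (𝓡 2) 1 γ (Icc a b))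
    (hγt : ContinuousOn γt (Icc a b)) (hlift : ∀ s ∈ Icc a b, pr (γt s) = γ s)
    (hN : γt u ∈ N) : ContDiffWithinAt ℝ 1 (φ ∘ γt) (Icc a b) u := by
  have hev := h.comp_eventuallyEq hu hγt hlift hN
  have hW : γ u ∈ W := hlift u hu ▸ h.mapsTo hN
  have h1 : ContMDiffWithinAt 𝓘(ℝ, ℝ) (𝓡 2) 1 (g ∘ γ) (Icc a b) u :=
    ((h.isLocalDiffeomorphOn ⟨_, hW⟩).contMDiffAt.of_le (by simp)).comp_contMDiffWithinAt u
      (hγ u hu)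
  exact (contMDiffWithinAt_iff_contDiffWithinAt.1 h1).congr_of_eventuallyEq hev
    (hev.self_of_nhdsWithin hu)

theorem planeVelocity_comp (h : IsDevelopment pr φ g W N) (hab : a < b) (hu : u ∈ Icc a b)
    (hγ : ContMDiffOn 𝓘(ℝ, ℝ) (𝓡 2) 1 γ (Icc a b))
    (hγt : ContinuousOn γt (Icc a b)) (hlift : ∀ s ∈ Icc a b, pr (γt s) = γ s)
    (hN : γt u ∈ N) :
    planeVelocity a b (φ ∘ γt) u = (tangentMap (𝓡 2) (𝓡 2) g (velocity a b γ u)).2 := by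
  have hev := h.comp_eventuallyEq hu hγt hlift hN
  have hW : γ u ∈ W := hlift u hu ▸ h.mapsTo hN
  have h1 := velocity_congr hu hev
  rw [velocity_comp hab hu (h.mdifferentiableAt hW) ((hγ u hu).mdifferentiableWithinAt one_ne_zero),
    velocity_plane] at h1
  exact congrArg (fun v : TangentBundle (𝓡 2) Plane ↦ (v.2 : Plane)) h1

end IsDevelopment

variable [ChartedSpace Plane Mt]

theorem exists_isDevelopment (hpr : IsLocalDiffeomorph (𝓡 2) (𝓡 2) ∞ pr)
    (hφ : IsLocalDiffeomorph (𝓡 2) (𝓡 2) ∞ φ) (x : Mt) :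
    ∃ g W N, IsDevelopment pr φ g W N ∧ x ∈ N := by
  refine ⟨φ ∘ (hpr x).localInverse, (hpr x).localInverse.source, (hpr x).localInverse.target,
    ⟨(hpr x).localInverse.open_source, (hpr x).localInverse.open_target, fun y hy ↦ ?_,
      fun y hy ↦ ?_, fun y ↦ ?_⟩, (hpr x).localInverse_mem_target⟩
  · have h1 := (hpr x).localInverse.map_target hy
    have h2 := (hpr x).localInverse_right_inv h1
    have h3 : (hpr x).localInverse ((hpr x).localInverse.toPartialEquiv.symm y) = y :=
      (hpr x).localInverse.right_inv hy
    rw [h3] at h2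
    rwa [h2]
  · simp only [Function.comp_apply]
    rw [(hpr x).localInverse_left_inv hy]
  · exact ((hpr x).localInverse.isLocalDiffeomorphAt _ _ _ y.2).comp _ _ (hφ _)

variable {a b : ℝ} {γ : ℝ → M} {γt : ℝ → Mt}

theorem contDiffOn_comp_lift (hpr : IsLocalDiffeomorph (𝓡 2) (𝓡 2) ∞ pr)
    (hφ : IsLocalDiffeomorph (𝓡 2) (𝓡 2) ∞ φ)
    (hγ : ContMDiffOn 𝓘(ℝ, ℝ) (𝓡 2) 1 γ (Icc a b))
    (hγt : ContinuousOn γt (Icc a b)) (hlift : ∀ s ∈ Icc a b, pr (γt s) = γ s) :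
    ContDiffOn ℝ 1 (φ ∘ γt) (Icc a b) := by
  intro u hu
  obtain ⟨g, W, N, h, hN⟩ := exists_isDevelopment hpr hφ (γt u)
  exact h.contDiffWithinAt_comp hu hγ hγt hlift hN

theorem planeVelocity_comp_lift_ne_zero (hpr : IsLocalDiffeomorph (𝓡 2) (𝓡 2) ∞ pr)
    (hφ : IsLocalDiffeomorph (𝓡 2) (𝓡 2) ∞ φ) (hab : a < b)
    (hγ : ContMDiffOn 𝓘(ℝ, ℝ) (𝓡 2) 1 γ (Icc a b))
    (hγt : ContinuousOn γt (Icc a b)) (hlift : ∀ s ∈ Icc a b, pr (γt s) = γ s) {u : ℝ}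
    (hu : u ∈ Icc a b) (hv : (velocity a b γ u).2 ≠ 0) :
    planeVelocity a b (φ ∘ γt) u ≠ 0 := by
  obtain ⟨g, W, N, h, hN⟩ := exists_isDevelopment hpr hφ (γt u)
  have hW : γ u ∈ W := hlift u hu ▸ h.mapsTo hN
  rw [h.planeVelocity_comp hab hu hγ hγt hlift hN]
  exact fun h0 ↦ hv ((map_eq_zero_iff _ (h.mfderiv_injective hW)).1 h0)

/-- The velocities in the plane of a lifted family of curves are continuous in both variables,
since locally they are the images of the velocities on `M` under a fixed tangent map. -/
theorem continuousOn_planeVelocity_comp_lift [IsManifold (𝓡 2) ∞ M]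
    (hpr : IsLocalDiffeomorph (𝓡 2) (𝓡 2) ∞ pr)
    (hφ : IsLocalDiffeomorph (𝓡 2) (𝓡 2) ∞ φ) (hab : a < b) {σ : ℝ → ℝ → M} {F : ℝ × ℝ → Mt}
    {S : Set ℝ} (hσ : ∀ t ∈ S, ContMDiffOn 𝓘(ℝ, ℝ) (𝓡 2) 1 (σ t) (Icc a b))
    (hv : ContinuousOn (fun q : ℝ × ℝ ↦ velocity a b (σ q.1) q.2) (S ×ˢ Icc a b))
    (hF : Continuous F) (hlift : ∀ t ∈ S, ∀ u ∈ Icc a b, pr (F (t, u)) = σ t u) :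
    ContinuousOn (fun q : ℝ × ℝ ↦ planeVelocity a b (fun u ↦ φ (F (q.1, u))) q.2)
      (S ×ˢ Icc a b) := by
  intro q hq
  obtain ⟨g, W, N, h, hN⟩ := exists_isDevelopment hpr hφ (F q)
  have hev : ∀ᶠ q' in nhdsWithin q (S ×ˢ Icc a b),
      planeVelocity a b (fun u ↦ φ (F (q'.1, u))) q'.2 =
        (tangentMap (𝓡 2) (𝓡 2) g (velocity a b (σ q'.1) q'.2)).2 := by
    filter_upwards [hF.continuousWithinAt (h.isOpen_cover.mem_nhds hN), self_mem_nhdsWithin]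
      with q' hq' hS
    exact h.planeVelocity_comp (γt := fun u ↦ F (q'.1, u)) hab hS.2 (hσ _ hS.1)
      (hF.comp (Continuous.prodMk_right _)).continuousOn (hlift _ hS.1) hq'
  have hW : σ q.1 q.2 ∈ W := hlift q.1 hq.1 q.2 hq.2 ▸ h.mapsTo hN
  have h1 : ContinuousAt (tangentMap (𝓡 2) (𝓡 2) g) (velocity a b (σ q.1) q.2) :=
    h.continuousOn_tangentMap.continuousAt
      ((h.isOpen_base.preimage (FiberBundle.continuous_proj Plane _)).mem_nhds hW)
  have h2 : ContinuousWithinAt (fun q : ℝ × ℝ ↦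
      ((tangentMap (𝓡 2) (𝓡 2) g (velocity a b (σ q.1) q.2)).2 : Plane)) (S ×ˢ Icc a b) q :=
    continuous_tangentBundle_plane_snd.continuousAt.comp_continuousWithinAt
      (ContinuousAt.comp_continuousWithinAt (f := fun q : ℝ × ℝ ↦ velocity a b (σ q.1) q.2) h1
        (hv q hq))
  exact h2.congr_of_eventuallyEq hev (hev.self_of_nhdsWithin hq)

variable [RiemannianBundle (fun x : M ↦ TangentSpace (𝓡 2) x)]

/-- Lifts of curves with the same direction, through the same point of the cover, have velocities
in the plane that are positive multiples of each other. -/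
theorem planeVelocity_comp_lift_eq_smul (hpr : IsLocalDiffeomorph (𝓡 2) (𝓡 2) ∞ pr)
    (hφ : IsLocalDiffeomorph (𝓡 2) (𝓡 2) ∞ φ) (hab : a < b)
    (hγ : ContMDiffOn 𝓘(ℝ, ℝ) (𝓡 2) 1 γ (Icc a b))
    (hγt : ContinuousOn γt (Icc a b)) (hlift : ∀ s ∈ Icc a b, pr (γt s) = γ s)
    {γ' : ℝ → M} {γt' : ℝ → Mt}
    (hγ' : ContMDiffOn 𝓘(ℝ, ℝ) (𝓡 2) 1 γ' (Icc a b))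
    (hγt' : ContinuousOn γt' (Icc a b)) (hlift' : ∀ s ∈ Icc a b, pr (γt' s) = γ' s)
    {u : ℝ} (hu : u ∈ Icc a b)
    (h0 : (velocity a b γ u).2 ≠ 0) (h0' : (velocity a b γ' u).2 ≠ 0)
    (hpt : γt' u = γt u) (hdir : direction a b γ' u = direction a b γ u) :
    ∃ k : ℝ, 0 < k ∧
      planeVelocity a b (φ ∘ γt') u = k • planeVelocity a b (φ ∘ γt) u := by
  obtain ⟨g, W, N, h, hN⟩ := exists_isDevelopment hpr hφ (γt u)
  obtain ⟨k, hk, hv⟩ := (direction_eq_iff h0 h0').1 hdir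
  refine ⟨k, hk, ?_⟩
  rw [h.planeVelocity_comp hab hu hγ hγt hlift hN,
    h.planeVelocity_comp hab hu hγ' hγt' hlift' (hpt ▸ hN), hv]
  exact map_smul (mfderiv (𝓡 2) (𝓡 2) g (γ u)) k _

end Development

/-! ### Invariance under regular homotopies -/

theorem exists_retraction_rectangle {a b c d : ℝ} (hcd : c ≤ d) (hab : a ≤ b) :
    ∃ r : ℝ × ℝ → ℝ × ℝ, Continuous r ∧ (∀ q, r q ∈ Icc c d ×ˢ Icc a b) ∧
      ∀ q ∈ Icc c d ×ˢ Icc a b, r q = q :=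
  ⟨fun q ↦ ((projIcc c d hcd q.1 : ℝ), (projIcc a b hab q.2 : ℝ)),
    (continuous_subtype_val.comp (continuous_projIcc.comp continuous_fst)).prodMk
      (continuous_subtype_val.comp (continuous_projIcc.comp continuous_snd)),
    fun _ ↦ ⟨Subtype.prop _, Subtype.prop _⟩,
    fun q hq ↦ by simp only [projIcc_of_mem hcd hq.1, projIcc_of_mem hab hq.2]⟩

section Homotopy

variable {M : Type*} [TopologicalSpace M] [ChartedSpace Plane M]
  [RiemannianBundle (fun x : M ↦ TangentSpace (𝓡 2) x)]

theorem mem_Icc_of_affine {a b : ℝ} (hab : a < b) (s : unitInterval) :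
    a + (s : ℝ) * (b - a) ∈ Icc a b :=
  ⟨by nlinarith [s.2.1], by nlinarith [s.2.2]⟩

theorem homotopyClass_eq_iff {a b : ℝ} (hab : a < b) {p : M} {γ₁ γ₂ : ℝ → M}
    (h₁ : IsRegularClosedCurve a b γ₁) (h₂ : IsRegularClosedCurve a b γ₂)
    (hp₁ : γ₁ a = p) (hp₂ : γ₂ a = p) :
    h₁.homotopyClass hab hp₁ = h₂.homotopyClass hab hp₂ ↔
      (loopOfCurve hab h₁.contMDiffOn.continuousOn hp₁ (h₁.closed ▸ hp₁)).Homotopic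
        (loopOfCurve hab h₂.contMDiffOn.continuousOn hp₂ (h₂.closed ▸ hp₂)) := by
  rw [← Path.Homotopic.Quotient.eq]
  exact ⟨fun h ↦ congrArg FundamentalGroup.toPath h, fun h ↦ congrArg FundamentalGroup.fromPath h⟩

variable {Mt : Type*} [TopologicalSpace Mt] {pr : Mt → M}

/-- Lifts of homotopic closed curves with the same initial point have the same end point. -/
theorem lift_apply_eq_of_homotopyClass_eq (hpr : IsCoveringMap pr) {a b : ℝ} (hab : a < b) {p : M}
    {γ₁ γ₂ : ℝ → M} (h₁ : IsRegularClosedCurve a b γ₁) (h₂ : IsRegularClosedCurve a b γ₂)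
    (hp₁ : γ₁ a = p) (hp₂ : γ₂ a = p)
    (h : h₁.homotopyClass hab hp₁ = h₂.homotopyClass hab hp₂) {pt : Mt} {γt₁ γt₂ : ℝ → Mt}
    (hl₁ : IsLiftFrom pr a b γ₁ pt γt₁) (hl₂ : IsLiftFrom pr a b γ₂ pt γt₂) :
    γt₁ b = γt₂ b := by
  rw [homotopyClass_eq_iff] at h
  have haI : a ∈ Icc a b := left_mem_Icc.2 hab.le
  have hpt₁ : p = pr pt := by rw [← hl₁.initial, hl₁.proj_eq a haI, hp₁]
  have key : ∀ (γ : ℝ → M) (hγ : ContinuousOn γ (Icc a b)) (ha : γ a = p) (hb : γ b = p)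
      (γt : ℝ → Mt), IsLiftFrom pr a b γ pt γt → ∀ h0,
      hpr.liftPath (loopOfCurve hab hγ ha hb).toContinuousMap pt h0 1 = γt b := by
    intro γ hγ ha hb γt hl h0
    have hc : Continuous fun s : unitInterval ↦ γt (a + (s : ℝ) * (b - a)) :=
      hl.continuousOn.comp_continuous (by fun_prop) (mem_Icc_of_affine hab)
    have := (hpr.eq_liftPath_iff h0 (Γ := fun s : unitInterval ↦ γt (a + (s : ℝ) * (b - a)))).2
      ⟨hc, funext fun s ↦ hl.proj_eq _ (mem_Icc_of_affine hab s), by simp [hl.initial]⟩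
    rw [← congrFun this 1]
    simp
  have := hpr.liftPath_apply_one_eq_of_homotopicRel h pt (by simpa using hpt₁)
    (by simpa using hpt₁)
  rwa [key _ _ _ _ _ hl₁, key _ _ _ _ _ hl₂] at this

variable [IsManifold (𝓡 2) ∞ M]

theorem IsRegularHomotopy.continuousOn_uncurry {a b : ℝ} {γ₁ γ₂ : ℝ → M} {σ : ℝ → ℝ → M}
    (h : IsRegularHomotopy a b γ₁ γ₂ σ) :
    ContinuousOn (fun q : ℝ × ℝ ↦ σ q.1 q.2) (Icc (0 : ℝ) 1 ×ˢ Icc a b) :=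
  (FiberBundle.continuous_proj Plane (TangentSpace (𝓡 2) : M → Type _)).comp_continuousOn
    h.continuousOn

theorem RegularlyHomotopicFixingBase.homotopyClass_eq {a b : ℝ} (hab : a < b) {p : M}
    {γ₁ γ₂ : ℝ → M} (h₁ : IsRegularClosedCurve a b γ₁) (h₂ : IsRegularClosedCurve a b γ₂)
    (hp₁ : γ₁ a = p) (hp₂ : γ₂ a = p) (h : RegularlyHomotopicFixingBase a b γ₁ γ₂) :
    h₁.homotopyClass hab hp₁ = h₂.homotopyClass hab hp₂ := by
  obtain ⟨σ, hσ, hbase⟩ := h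
  rw [homotopyClass_eq_iff]
  refine ⟨⟨⟨⟨fun q ↦ σ q.1 (a + (q.2 : ℝ) * (b - a)), ?_⟩, fun s ↦ ?_, fun s ↦ ?_⟩, ?_⟩⟩
  · exact hσ.continuousOn_uncurry.comp_continuous
      (f := fun q : unitInterval × unitInterval ↦ ((q.1 : ℝ), a + (q.2 : ℝ) * (b - a)))
      (by fun_prop) fun q ↦ ⟨q.1.2, mem_Icc_of_affine hab q.2⟩
  · exact hσ.start (mem_Icc_of_affine hab s)
  · exact hσ.finish (mem_Icc_of_affine hab s)
  · intro t s hs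
    have h1 : σ t a = γ₁ a := (hbase t t.2).1
    rcases hs with rfl | hs
    · simp [loopOfCurve, h1]
    · obtain rfl : s = 1 := hs
      simp [loopOfCurve, ← (hσ.regular t t.2).closed, h1, h₁.closed]

/-- The lift of a regular homotopy to the cover joins the two given lifts and has fixed end
points. -/
theorem exists_lift_homotopy (hpr : IsCoveringMap pr) {a b : ℝ} (hab : a < b)
    {γ₁ γ₂ : ℝ → M} {σ : ℝ → ℝ → M} (hσ : IsRegularHomotopy a b γ₁ γ₂ σ)
    (hbase : ∀ t ∈ Icc (0 : ℝ) 1, σ t a = γ₁ a) {pt : Mt} {γt₁ γt₂ : ℝ → Mt}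
    (hl₁ : IsLiftFrom pr a b γ₁ pt γt₁) (hl₂ : IsLiftFrom pr a b γ₂ pt γt₂) :
    ∃ F : ℝ × ℝ → Mt, Continuous F ∧
      (∀ t ∈ Icc (0 : ℝ) 1, ∀ u ∈ Icc a b, pr (F (t, u)) = σ t u) ∧
      (∀ u ∈ Icc a b, F (0, u) = γt₁ u) ∧ (∀ u ∈ Icc a b, F (1, u) = γt₂ u) ∧
      (∀ t ∈ Icc (0 : ℝ) 1, F (t, a) = F (0, a)) ∧
      (∀ t ∈ Icc (0 : ℝ) 1, F (t, b) = F (0, b)) := by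
  have haI : a ∈ Icc a b := left_mem_Icc.2 hab.le
  have hbI : b ∈ Icc a b := right_mem_Icc.2 hab.le
  have h0I : (0 : ℝ) ∈ Icc (0 : ℝ) 1 := by simp
  have h1I : (1 : ℝ) ∈ Icc (0 : ℝ) 1 := by simp
  obtain ⟨r, hrc, hrS, hr⟩ := exists_retraction_rectangle zero_le_one hab.le
  have hrid : ∀ t ∈ Icc (0 : ℝ) 1, ∀ u ∈ Icc a b, r (t, u) = (t, u) := fun t ht u hu ↦
    hr (t, u) ⟨ht, hu⟩
  have hc := hσ.continuousOn_uncurry.comp_continuous hrc hrS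
  obtain ⟨F, ⟨hF0, hF⟩, -⟩ := hpr.existsUnique_continuousMap_lifts ⟨_, hc⟩ (0, a) pt (by
    simp only [ContinuousMap.coe_mk, Function.comp_apply, hrid 0 h0I a haI]
    rw [hσ.start haI, ← hl₁.proj_eq a haI, hl₁.initial])
  have hlift : ∀ t ∈ Icc (0 : ℝ) 1, ∀ u ∈ Icc a b, pr (F (t, u)) = σ t u := fun t ht u hu ↦ by
    have := congrFun hF (t, u)
    simpa only [Function.comp_apply, ContinuousMap.coe_mk, hrid t ht u hu] using this
  have hcu : ∀ t, ContinuousOn (fun u ↦ F (t, u)) (Icc a b) := fun t ↦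
    (F.continuous.comp (Continuous.prodMk_right t)).continuousOn
  have hct : ∀ u, ContinuousOn (fun t ↦ F (t, u)) (Icc 0 1) := fun u ↦
    (F.continuous.comp (Continuous.prodMk_left u)).continuousOn
  have hconst : ∀ u ∈ Icc a b, (∀ t ∈ Icc (0 : ℝ) 1, σ t u = σ 0 u) →
      ∀ t ∈ Icc (0 : ℝ) 1, F (t, u) = F (0, u) := fun u hu hfix ↦
    hpr.eqOn_of_comp_eqOn (g₁ := fun t ↦ F (t, u)) (g₂ := fun _ ↦ F (0, u)) isPreconnected_Icc
      (hct u) continuousOn_const (fun t ht ↦ by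
        simp only [Function.comp_apply, hlift t ht u hu, hlift 0 h0I u hu, hfix t ht]) h0I rfl
  have ha := hconst a haI fun t ht ↦ by rw [hbase t ht, hbase 0 h0I]
  refine ⟨F, F.continuous, hlift, ?_, ?_, ha, hconst b hbI fun t ht ↦ ?_⟩
  · exact hpr.eqOn_of_comp_eqOn (g₁ := fun u ↦ F (0, u)) isPreconnected_Icc (hcu 0)
      hl₁.continuousOn (fun u hu ↦ by
        simp only [Function.comp_apply, hlift 0 h0I u hu, hl₁.proj_eq u hu, hσ.start hu]) haI
      (hF0.trans hl₁.initial.symm)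
  · exact hpr.eqOn_of_comp_eqOn (g₁ := fun u ↦ F (1, u)) isPreconnected_Icc (hcu 1)
      hl₂.continuousOn (fun u hu ↦ by
        simp only [Function.comp_apply, hlift 1 h1I u hu, hl₂.proj_eq u hu, hσ.finish hu]) haI
      ((ha 1 h1I).trans (hF0.trans hl₂.initial.symm))
  · rw [← (hσ.regular t ht).closed, ← (hσ.regular 0 h0I).closed, hbase t ht, hbase 0 h0I]

theorem exp_im_eq_of_exp_eq_mul {z w : ℂ} {k : ℝ} (hk : 0 < k)
    (h : Complex.exp z = k * Complex.exp w) :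
    Complex.exp (z.im * Complex.I) = Complex.exp (w.im * Complex.I) := by
  have h1 : Real.exp z.re = k * Real.exp w.re := by
    have := congrArg norm h
    rwa [norm_mul, Complex.norm_exp, Complex.norm_exp, Complex.norm_real,
      Real.norm_of_nonneg hk.le] at this
  have h2 : ∀ y : ℂ, Complex.exp (y.im * Complex.I) = Complex.exp y / Real.exp y.re := fun y ↦ by
    rw [Complex.ofReal_exp, ← Complex.exp_sub]
    congr 1
    apply Complex.ext <;> simp
  have hk' : (k : ℂ) ≠ 0 := by exact_mod_cast hk.ne'
  rw [h2, h2, h, h1]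
  push_cast
  rw [mul_div_mul_left _ _ hk']

variable [ChartedSpace Plane Mt]

/-- The index of the lifts is invariant: the angles of the lifted homotopy form a continuous
function of two variables, and at the end points they are constant modulo `2π`. -/
theorem RegularlyHomotopicFixingBase.iIndex_eq (hpr : IsCoveringMap pr)
    (hpr' : IsLocalDiffeomorph (𝓡 2) (𝓡 2) ∞ pr) {φ : Mt → Plane}
    (hφ : IsLocalDiffeomorph (𝓡 2) (𝓡 2) ∞ φ) {a b : ℝ} (hab : a < b)
    {γ₁ γ₂ : ℝ → M} (h : RegularlyHomotopicFixingBase a b γ₁ γ₂) {pt : Mt} {γt₁ γt₂ : ℝ → Mt}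
    (hl₁ : IsLiftFrom pr a b γ₁ pt γt₁) (hl₂ : IsLiftFrom pr a b γ₂ pt γt₂) :
    iIndex a b (φ ∘ γt₁) = iIndex a b (φ ∘ γt₂) := by
  obtain ⟨σ, hσ, hbase⟩ := h
  have haI : a ∈ Icc a b := left_mem_Icc.2 hab.le
  have hbI : b ∈ Icc a b := right_mem_Icc.2 hab.le
  have h0I : (0 : ℝ) ∈ Icc (0 : ℝ) 1 := by simp
  have h1I : (1 : ℝ) ∈ Icc (0 : ℝ) 1 := by simp
  obtain ⟨F, hF, hlift, hF₁, hF₂, hFa, hFb⟩ :=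
    exists_lift_homotopy hpr hab hσ (fun t ht ↦ (hbase t ht).1) hl₁ hl₂
  have hcu : ∀ t, ContinuousOn (fun u ↦ F (t, u)) (Icc a b) := fun t ↦
    (hF.comp (Continuous.prodMk_right t)).continuousOn
  set c : ℝ → ℝ → Plane := fun t u ↦ φ (F (t, u)) with hc
  have hVc : ContinuousOn (fun q : ℝ × ℝ ↦ planeVelocity a b (c q.1) q.2)
      (Icc (0 : ℝ) 1 ×ˢ Icc a b) :=
    continuousOn_planeVelocity_comp_lift hpr' hφ hab (fun t ht ↦ (hσ.regular t ht).contMDiffOn)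
      hσ.continuousOn hF hlift
  have hV0 : ∀ t ∈ Icc (0 : ℝ) 1, ∀ u ∈ Icc a b, planeVelocity a b (c t) u ≠ 0 :=
    fun t ht u hu ↦ planeVelocity_comp_lift_ne_zero hpr' hφ hab (hσ.regular t ht).contMDiffOn
      (hcu t) (hlift t ht) hu ((hσ.regular t ht).velocity_ne_zero u hu)
  obtain ⟨r, hrc, hrS, hrid⟩ := exists_retraction_rectangle zero_le_one hab.le
  obtain ⟨L, hL⟩ := exists_continuous_log_of_retraction
    (V := fun q : ℝ × ℝ ↦ planeEquivComplex (planeVelocity a b (c q.1) q.2)) hrc hrS hrid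
    (planeEquivComplex.continuous.comp_continuousOn hVc)
    (fun q hq ↦ by simpa using hV0 q.1 hq.1 q.2 hq.2)
  have hind : ∀ t ∈ Icc (0 : ℝ) 1, ∀ γt : ℝ → Mt, (∀ u ∈ Icc a b, F (t, u) = γt u) →
      iIndex a b (φ ∘ γt) = ((L (t, b)).im - (L (t, a)).im) / (2 * Real.pi) := by
    intro t ht γt hγt
    refine iIndex_eq_of_exp_eq hab.le (L := fun u ↦ L (t, u))
      (L.continuous.comp (Continuous.prodMk_right t)).continuousOn fun u hu ↦ ?_
    rw [hL (t, u) ⟨ht, hu⟩]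
    simp only [planeVelocity]
    have heq : EqOn (φ ∘ γt) (c t) (Icc a b) := fun s hs ↦ by
      simp only [hc, Function.comp_apply, hγt s hs]
    rw [derivWithin_congr heq (heq hu)]
  have hconst : ∀ u ∈ Icc a b, (∀ t ∈ Icc (0 : ℝ) 1, F (t, u) = F (0, u)) →
      (∀ t ∈ Icc (0 : ℝ) 1, direction a b (σ t) u = direction a b (σ 0) u) →
      (L (0, u)).im = (L (1, u)).im := by
    intro u hu hFu hdir
    have hk : ∀ t ∈ Icc (0 : ℝ) 1, Complex.exp ((L (t, u)).im * Complex.I) =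
        Complex.exp ((L (0, u)).im * Complex.I) := by
      intro t ht
      obtain ⟨k, hk, hkv⟩ := planeVelocity_comp_lift_eq_smul hpr' hφ hab
        (hσ.regular 0 h0I).contMDiffOn (hcu 0) (hlift 0 h0I) (hσ.regular t ht).contMDiffOn
        (hcu t) (hlift t ht) hu ((hσ.regular 0 h0I).velocity_ne_zero u hu)
        ((hσ.regular t ht).velocity_ne_zero u hu) (hFu t ht) (hdir t ht)
      refine exp_im_eq_of_exp_eq_mul hk ?_
      rw [hL (t, u) ⟨ht, hu⟩, hL (0, u) ⟨h0I, hu⟩, ← Complex.real_smul, ← map_smul]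
      exact congrArg _ hkv
    exact angle_const_of_isPreconnected (f := fun t ↦ (L (t, u)).im) isPreconnected_Icc
      (Complex.continuous_im.comp (L.continuous.comp (Continuous.prodMk_left u))).continuousOn
      (fun s hs t ht ↦ (hk s hs).trans (hk t ht).symm) h0I h1I
  have hdira : ∀ t ∈ Icc (0 : ℝ) 1, direction a b (σ t) a = direction a b (σ 0) a :=
    fun t ht ↦ (hbase t ht).2.trans (hbase 0 h0I).2.symm
  rw [hind 0 h0I γt₁ hF₁, hind 1 h1I γt₂ hF₂, hconst a haI hFa hdira,
    hconst b hbI hFb fun t ht ↦ by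
      rw [← (hσ.regular t ht).direction_eq, ← (hσ.regular 0 h0I).direction_eq, hdira t ht]]

end Homotopy

/-! ### Regular homotopies from the plane -/

section Regularity

variable {M : Type*} [TopologicalSpace M] [ChartedSpace Plane M]
  {Mt : Type*} [TopologicalSpace Mt] [ChartedSpace Plane Mt]

/-- The covering map, read in the plane through an injective local diffeomorphism `φ`, is a local
diffeomorphism on the image of `φ`. -/
theorem exists_isLocalDiffeomorphOn_range {pr : Mt → M}
    (hpr : IsLocalDiffeomorph (𝓡 2) (𝓡 2) ∞ pr) {φ : Mt → Plane}
    (hφ : IsLocalDiffeomorph (𝓡 2) (𝓡 2) ∞ φ) (hinj : Function.Injective φ) (x₀ : Mt) :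
    ∃ q : Plane → M, (∀ x, q (φ x) = pr x) ∧
      IsLocalDiffeomorphOn (𝓡 2) (𝓡 2) ∞ q (range φ) := by
  have : Nonempty Mt := ⟨x₀⟩
  have hleft : ∀ x, Function.invFun φ (φ x) = x := Function.leftInverse_invFun hinj
  refine ⟨pr ∘ Function.invFun φ, fun x ↦ by simp [hleft], ?_⟩
  rintro ⟨_, x, rfl⟩
  obtain ⟨Φ, hx, hΦ⟩ := hφ x
  have hsymm : IsLocalDiffeomorphAt (𝓡 2) (𝓡 2) ∞ (Function.invFun φ) (φ x) := by
    refine ⟨Φ.symm, ?_, fun y hy ↦ ?_⟩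
    · rw [hΦ hx]; exact Φ.map_source hx
    · have h1 : φ (Φ.symm y) = y := (hΦ (Φ.map_target hy)).trans (Φ.right_inv hy)
      rw [← h1, hleft, h1]
  refine hsymm.comp _ _ ?_
  rw [hleft]
  exact hpr x

/-- If a family of regular curves in the plane has the end points and the end directions of
`c₁`, then its image under a regular map `Q` to a surface is a regular homotopy that fixes the base
point and the base direction, as soon as `Q ∘ c₁` is a regular closed curve. -/
theorem regularlyHomotopicFixingBase_of_planar [IsManifold (𝓡 2) ∞ M]
    [RiemannianBundle (fun x : M ↦ TangentSpace (𝓡 2) x)] {a b : ℝ} (hab : a < b)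
    {Q : Plane → M} (hQ : ContMDiff (𝓡 2) (𝓡 2) 1 Q)
    (hQinj : ∀ x, Function.Injective (mfderiv (𝓡 2) (𝓡 2) Q x))
    {γ₁ γ₂ : ℝ → M} (h₁ : IsRegularClosedCurve a b γ₁) {c₁ c₂ : ℝ → Plane}
    (hc₁ : ContDiffOn ℝ 1 c₁ (Icc a b))
    (hγ₁ : ∀ u ∈ Icc a b, Q (c₁ u) = γ₁ u) (hγ₂ : ∀ u ∈ Icc a b, Q (c₂ u) = γ₂ u)
    {C V : ℝ → ℝ → Plane} (hC : Continuous (Function.uncurry C))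
    (hV : Continuous (Function.uncurry V)) (hCV : ∀ t u, HasDerivAt (C t) (V t u) u)
    (hV0 : ∀ t u, V t u ≠ 0) (hCa : ∀ t, C t a = c₁ a) (hCb : ∀ t, C t b = c₁ b)
    (hVa : ∀ t, ∃ k : ℝ, 0 < k ∧ V t a = k • planeVelocity a b c₁ a)
    (hVb : ∀ t, ∃ k : ℝ, 0 < k ∧ V t b = k • planeVelocity a b c₁ b)
    (hC0 : EqOn (C 0) c₁ (Icc a b)) (hC1 : EqOn (C 1) c₂ (Icc a b)) :
    RegularlyHomotopicFixingBase a b γ₁ γ₂ := by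
  have haI : a ∈ Icc a b := left_mem_Icc.2 hab.le
  have hbI : b ∈ Icc a b := right_mem_Icc.2 hab.le
  have : IsManifold (𝓡 2) 1 M := .of_le (n := ∞) (by simp)
  have hQd : ∀ x, MDifferentiableAt (𝓡 2) (𝓡 2) Q x := fun x ↦
    hQ.mdifferentiableAt one_ne_zero
  have hvel : ∀ t, ∀ u ∈ Icc a b,
      velocity a b (Q ∘ C t) u = tangentMap (𝓡 2) (𝓡 2) Q ⟨C t u, V t u⟩ := by
    intro t u hu
    rw [velocity_comp hab hu (hQd _)
      (hCV t u).differentiableAt.differentiableWithinAt.mdifferentiableWithinAt, velocity_plane]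
    rw [planeVelocity, (hCV t u).hasDerivWithinAt.derivWithin (uniqueDiffOn_Icc hab u hu)]
  have hvel₁ : ∀ u ∈ Icc a b,
      velocity a b γ₁ u = tangentMap (𝓡 2) (𝓡 2) Q ⟨c₁ u, planeVelocity a b c₁ u⟩ := by
    intro u hu
    rw [← velocity_plane, ← velocity_comp hab hu (hQd _)
      (hc₁.differentiableOn one_ne_zero u hu).mdifferentiableWithinAt]
    refine velocity_congr hu ?_
    filter_upwards [self_mem_nhdsWithin] with s hs using (hγ₁ s hs).symm
  have hne : ∀ t, ∀ u ∈ Icc a b, (velocity a b (Q ∘ C t) u).2 ≠ 0 := by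
    intro t u hu
    rw [hvel t u hu]
    exact fun h0 ↦ hV0 t u ((map_eq_zero_iff _ (hQinj (C t u))).1 h0)
  have hdir : ∀ t, ∀ u ∈ Icc a b, C t u = c₁ u →
      (∃ k : ℝ, 0 < k ∧ V t u = k • planeVelocity a b c₁ u) →
      direction a b (Q ∘ C t) u = direction a b γ₁ u := by
    rintro t u hu hCu ⟨k, hk, hVu⟩
    refine (direction_eq_iff (h₁.velocity_ne_zero u hu) (hne t u hu)).2 ⟨k, hk, ?_⟩
    rw [hvel t u hu, hvel₁ u hu, hCu, hVu, ← hγ₁ u hu]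
    simp only [tangentMap]
    congr 1
    exact map_smul (mfderiv (𝓡 2) (𝓡 2) Q (c₁ u)) k _
  have hdira := fun t ↦ hdir t a haI (hCa t) (hVa t)
  have hdirb := fun t ↦ hdir t b hbI (hCb t) (hVb t)
  refine ⟨fun t ↦ Q ∘ C t, ⟨fun t _ ↦ ⟨?_, hne t, ?_, ?_⟩, ?_, fun u hu ↦ ?_, fun u hu ↦ ?_⟩,
    fun t _ ↦ ⟨?_, hdira t⟩⟩
  · have hCt : ContDiff ℝ 1 (C t) := by
      refine contDiff_one_iff_deriv.2 ⟨fun u ↦ (hCV t u).differentiableAt, ?_⟩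
      rw [funext fun u ↦ (hCV t u).deriv]
      exact hV.uncurry_left t
    exact (hQ.comp hCt.contMDiff).contMDiffOn
  · simp only [Function.comp_apply, hCa, hCb, hγ₁ a haI, hγ₁ b hbI, h₁.closed]
  · rw [hdira, hdirb, h₁.direction_eq]
  · refine ((hQ.continuous_tangentMap le_rfl).comp
      (continuous_tangentBundle_plane_mk hC hV)).continuousOn.congr fun q hq ↦ ?_
    exact hvel q.1 q.2 hq.2
  · simp only [Function.comp_apply, hC0 hu, hγ₁ u hu]
  · simp only [Function.comp_apply, hC1 hu, hγ₂ u hu]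
  · simp only [Function.comp_apply, hCa, hγ₁ a haI]

end Regularity

theorem theorem3
    {M : Type*} [TopologicalSpace M] [T2Space M] [SecondCountableTopology M] [ConnectedSpace M]
    [ChartedSpace Plane M] [IsManifold (𝓡 2) ∞ M]
    [RiemannianBundle (fun x : M ↦ TangentSpace (𝓡 2) x)]
    [IsContMDiffRiemannianBundle (𝓡 2) ∞ Plane (fun x : M ↦ TangentSpace (𝓡 2) x)]
    {Mt : Type*} [TopologicalSpace Mt] [ChartedSpace Plane Mt] [IsManifold (𝓡 2) ∞ Mt]
    [RiemannianBundle (fun x : Mt ↦ TangentSpace (𝓡 2) x)]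
    (pr : Mt → M) (hpr : IsRiemannianUniversalCover pr)
    (φ : Mt → Plane) (hφ : IsTameConformallyEuclidean φ)
    (a b : ℝ) (hab : a < b) (p : M) (pt : Mt) (hpt : pr pt = p)
    (γ₁ γ₂ : ℝ → M) (h₁ : IsRegularClosedCurve a b γ₁) (h₂ : IsRegularClosedCurve a b γ₂)
    (hp₁ : γ₁ a = p) (hp₂ : γ₂ a = p)
    (hdir : direction a b γ₁ a = direction a b γ₂ a)
    (γt₁ γt₂ : ℝ → Mt) (hl₁ : IsLiftFrom pr a b γ₁ pt γt₁) (hl₂ : IsLiftFrom pr a b γ₂ pt γt₂) :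
    RegularlyHomotopicFixingBase a b γ₁ γ₂ ↔
      h₁.homotopyClass hab hp₁ = h₂.homotopyClass hab hp₂ ∧
        iIndex a b (φ ∘ γt₁) = iIndex a b (φ ∘ γt₂) := by
  have hpd := hpr.isLocalDiffeomorph
  have hφd := hφ.isConformalEmbedding.isLocalDiffeomorph
  have haI : a ∈ Icc a b := left_mem_Icc.2 hab.le
  refine ⟨fun h ↦ ⟨h.homotopyClass_eq hab h₁ h₂ hp₁ hp₂,
    h.iIndex_eq hpr.isCoveringMap hpd hφd hab hl₁ hl₂⟩, fun ⟨hclass, hindex⟩ ↦ ?_⟩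
  have hend := lift_apply_eq_of_homotopyClass_eq hpr.isCoveringMap hab h₁ h₂ hp₁ hp₂ hclass hl₁ hl₂
  have hc₁ := contDiffOn_comp_lift hpd hφd h₁.contMDiffOn hl₁.continuousOn hl₁.proj_eq
  have hc₂ := contDiffOn_comp_lift hpd hφd h₂.contMDiffOn hl₂.continuousOn hl₂.proj_eq
  have hpt₂ : γt₂ a = γt₁ a := hl₂.initial.trans hl₁.initial.symm
  obtain ⟨C, V, hC, hV, hCV, hV0, hCa, hCb, hVa, hVb, hC0, hC1⟩ :=
    exists_planar_regular_homotopy hab hc₁ hc₂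
      (fun u hu ↦ planeVelocity_comp_lift_ne_zero hpd hφd hab h₁.contMDiffOn hl₁.continuousOn
        hl₁.proj_eq hu (h₁.velocity_ne_zero u hu))
      (fun u hu ↦ planeVelocity_comp_lift_ne_zero hpd hφd hab h₂.contMDiffOn hl₂.continuousOn
        hl₂.proj_eq hu (h₂.velocity_ne_zero u hu))
      (by simp [hpt₂]) (by simp [hend])
      (planeVelocity_comp_lift_eq_smul hpd hφd hab h₁.contMDiffOn hl₁.continuousOn hl₁.proj_eq
        h₂.contMDiffOn hl₂.continuousOn hl₂.proj_eq haI (h₁.velocity_ne_zero a haI)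
        (h₂.velocity_ne_zero a haI) hpt₂ hdir.symm)
      hindex
  obtain ⟨q, hq, hqd⟩ :=
    exists_isLocalDiffeomorphOn_range hpd hφd hφ.isConformalEmbedding.injective pt
  -- the planar homotopy is pushed into the image of `φ` by a regular map that fixes both curves
  obtain ⟨f, hf, hfinj, hfr, hfK⟩ := hφ.exists_retraction
    ((φ ∘ γt₁) '' Icc a b ∪ (φ ∘ γt₂) '' Icc a b)
    ((isCompact_Icc.image_of_continuousOn hc₁.continuousOn).union
      (isCompact_Icc.image_of_continuousOn hc₂.continuousOn))
    (union_subset (by rintro _ ⟨u, -, rfl⟩; exact mem_range_self _)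
      (by rintro _ ⟨u, -, rfl⟩; exact mem_range_self _))
  have hqf : ∀ x, IsLocalDiffeomorphAt (𝓡 2) (𝓡 2) ∞ q (f x) := fun x ↦ hqd ⟨f x, hfr x⟩
  refine regularlyHomotopicFixingBase_of_planar hab (Q := q ∘ f) (fun x ↦ ?_) (fun x ↦ ?_) h₁ hc₁
    (fun u hu ↦ ?_) (fun u hu ↦ ?_) hC hV hCV hV0 hCa hCb hVa hVb hC0 hC1
  · exact ((hqf x).contMDiffAt.of_le (by simp)).comp x hf.contMDiff.contMDiffAt
  · rw [mfderiv_comp x ((hqf x).mdifferentiableAt (by simp))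
      (hf.contMDiff.mdifferentiableAt one_ne_zero), mfderiv_eq_fderiv]
    exact ((hqf x).mfderivToContinuousLinearEquiv (by simp)).injective.comp (hfinj x)
  · have h : f (φ (γt₁ u)) = φ (γt₁ u) := hfK (Or.inl (mem_image_of_mem _ hu))
    simp only [Function.comp_apply, h, hq, hl₁.proj_eq u hu]
  · have h : f (φ (γt₂ u)) = φ (γt₂ u) := hfK (Or.inr (mem_image_of_mem _ hu))
    simp only [Function.comp_apply, h, hq, hl₂.proj_eq u hu]
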